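/- Let $(R,\mathfrak m)$ be a Cohen–Macaulay local ring with $\dim R=1$ and total ring of fractions $K$; all colons $X:Y=\{x\in K\mid xY\subseteq X\}$ are taken in $K$. An ideal $I$ of a one-dimensional Cohen–Macaulay local ring $(R,\mathfrak m)$ is called an Ulrich ideal if it is $\mathfrak m$-primary, it contains a parameter ideal $Q=(a)$ with $I\neq Q$ and $I^2=QI$, and $I/I^2$ is a free $R/I$-module. Write $\mu_R(I)$ for the minimal number of generators of $I$, $\mathrm r(R)=\dim_{R/\mathfrak m}\operatorname{Ext}^1_R(R/\mathfrak m,R)$ for the Cohen–Macaulay type, $\mathrm e(R)=\lim_{n\to\infty}\ell_R(R/\mathfrak m^n)/n$ for the multiplicity and $\mathrm v(R)=\mu_R(\mathfrak m)$ for the embedding dimension. Let $I\subsetneq J$ be Ulrich ideals of $R$, let $b\in J$ satisfy $J^2=bJ$ (then $b$ is invertible in $K$), and put $B=J:J$ and $\frac Ib=b^{-1}I\subseteq K$. Then: 1. $B=R+\frac Ib$ and $\frac Ib=I:J$. 2. $B$ is a Cohen–Macaulay local ring with $\dim B=1$ and maximal ideal $\mathfrak n=\mathfrak m+\frac Ib$;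 hence $R/\mathfrak m\cong B/\mathfrak n$ as $R$-algebras. 3. $\frac Ib$ is an Ulrich ideal of $B$ and $\mu_B(\frac Ib)=\mu_R(I)$. 4. $\mathrm r(B)=\mathrm r(R)$ and $\mathrm e(B)=\mathrm e(R)$. Therefore $\mathrm v(B)=\mathrm e(B)$ if and only if $\mathrm v(R)=\mathrm e(R)$. -/

import Mathlib

open IsLocalRing Filter Topology

noncomputable section

/-- A Cohen–Macaulay local ring: a Noetherian local ring `R` possessing an `R`-regular sequence of
length `dim R`. (Such a sequence lies in the maximal ideal because `IsRegular` demands that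
`R / (rs) ≠ 0`.) -/
class IsCohenMacaulayLocalRing (R : Type*) [CommRing R] : Prop extends
    IsLocalRing R, IsNoetherianRing R where
  exists_regular_sequence : ∃ rs : List R,
    RingTheory.Sequence.IsRegular R rs ∧ (rs.length : WithBot ℕ∞) = ringKrullDim R

/-- Ulrich ideals of a local ring of dimension one. The ideal `I` is primary to the maximal ideal,
and it contains a parameter ideal `Q = (a)` such that `I ≠ Q` and `I² = QI` (so that `Q` is a
reduction of `I`); moreover `I/I²` is a free `R/I`-module. -/
structure IsUlrichIdeal {R : Type*} [CommRing R] [IsLocalRing R] (I : Ideal R) : Prop where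
  radical_eq : I.radical = maximalIdeal R
  exists_parameter : ∃ a ∈ I, (Ideal.span {a}).radical = maximalIdeal R ∧
    I ≠ Ideal.span {a} ∧ I ^ 2 = Ideal.span {a} * I
  free_cotangent : Module.Free (R ⧸ I) I.Cotangent

/-- The Cohen–Macaulay type `dim_k Ext¹_R(k, R)` of a one-dimensional Cohen–Macaulay local ring `R`
with residue field `k`. The module `Ext¹_R(k, R)` is killed by the maximal ideal, so its
`k`-dimension is its length as an `R`-module. -/
def cmType (R : Type*) [CommRing R] [IsLocalRing R] : ℕ∞ :=
  Module.length R
    (CategoryTheory.Abelian.Ext (ModuleCat.of R (ResidueField R)) (ModuleCat.of R R) 1)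

/-- The sequence `n ↦ ℓ_R(R/𝔪ⁿ) / n` of real numbers, for a local ring `R`. -/
def hilbertSamuelRatio (R : Type*) [CommRing R] [IsLocalRing R] (n : ℕ) : ℝ :=
  ((Module.length R (R ⧸ maximalIdeal R ^ n)).toNat : ℝ) / n

/-- The multiplicity `e(R) = lim ℓ_R(R/𝔪ⁿ) / n` of a one-dimensional Noetherian local ring. -/
def localMultiplicity (R : Type*) [CommRing R] [IsLocalRing R] : ℝ :=
  limUnder atTop (hilbertSamuelRatio R)

/-- The embedding dimension `v(R) = μ_R(𝔪)`. -/
def embeddingDim (R : Type*) [CommRing R] [IsLocalRing R] : ℕ :=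
  (maximalIdeal R).spanFinrank

section TotalFractions

variable {R : Type*} [CommRing R] (K : Type*) [CommRing K] [Algebra R K]

/-- The ring `J : J = {x ∈ K | x J ⊆ J}`, as an `R`-subalgebra of `K`. -/
def endColon (J : Ideal R) : Subalgebra R K where
  carrier := ↑(IsLocalization.coeSubmodule K J / IsLocalization.coeSubmodule K J)
  mul_mem' := by
    intro x y hx hy
    simp only [SetLike.mem_coe, Submodule.mem_div_iff_forall_mul_mem] at hx hy ⊢
    intro z hz
    rw [mul_assoc]
    exact hx _ (hy _ hz)
  add_mem' := by
    intro x y hx hy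
    exact Submodule.add_mem _ hx hy
  algebraMap_mem' := by
    intro r
    simp only [SetLike.mem_coe, Submodule.mem_div_iff_forall_mul_mem]
    intro z hz
    rw [← Algebra.smul_def]
    exact Submodule.smul_mem _ _ hz

/-- `I / b = b⁻¹ I`, as an `R`-submodule of `K`: the set of all `x ∈ K` with `b x ∈ I`
(used for elements `b` of `R` that are units in `K`). -/
def fracBy (I : Ideal R) (b : R) : Submodule R K :=
  (IsLocalization.coeSubmodule K I).comap (LinearMap.lsmul R K b)

variable {K}

/-- An ideal of an `R`-subalgebra `B` of `K`, viewed as an `R`-submodule of `K`. -/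
def idealToSubmodule {B : Subalgebra R K} (𝔟 : Ideal B) : Submodule R K :=
  (𝔟.restrictScalars R).map B.val.toLinearMap

end TotalFractions

end

/-! Since `J² = bJ`, multiplication by `b` identifies `B = J : J` with `J`; everything about `B` is
read off in `R` through this linear map `T` (`IsMulEndColon`).

If `a` generates the reduction of `I`, then `I/(a)` is free and nonzero over `R/I`, so some
generator `x` of `I` has `(a) : x ⊆ I`. This membership test, applied to `I` and to `J`, carries the
comparison. For `j ∈ J` write `aj = bs`, as `aj ∈ J² = bJ`. The test puts `s` in `I`, and expanding
`s` in a basis of the conormal module yields `J = I + (b)` and `I² = aI ⊆ b(I : b)I`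
(`IsUlrichBasis.exists_coeff`, `IsUlrichBasis.exists_mul_mul_eq`). Hence `𝔞 = I/b` is an ideal of
`B`, `B = R + 𝔞`, and `𝔞² ⊆ (I : b)𝔞 ⊆ 𝔪𝔞`. So `𝔞` lies in every maximal ideal of the finite
extension `B`, which is therefore local with the residue field of `R`; a basis of `I/I²` divided by
`b` is one of `𝔞/𝔞²`.

The type is the length of the socle modulo `a`, which `T` transports from `B` to `R`
(`IsUlrichBlowup.cmType_eq`). The colengths of `𝔪ᵏ` and `𝔫ᵏ` differ by at most `ℓ(R/(b))`, so the
multiplicities agree.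

For minimal multiplicity, a ring with an Ulrich ideal satisfies `v = e` if and only if `r + 1 = e`
(`IsUlrichIdeal.exists_multiplicity`), and `r`, `e` are already known to agree. With `D = (a) : 𝔪`
one has `𝔪D = a𝔪` and `ℓ(D/𝔪D) = r + 1`, and the Hilbert functions of `D` and `R` coincide from
index one on. Over an infinite residue field a general `x ∈ 𝔪` would turn the extremal cases into
`𝔪D = xD` and `𝔪² = x𝔪`. As the residue field is arbitrary, `x` is replaced by a polynomial `ξ`
whose coefficients generate `𝔪`, acting on polynomials of degree less than `p`. Such equalities then
hold up to a length independent of `p`, which disappears after division by `p`. -/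

noncomputable section

/-! ### Lengths of subquotients, without assuming nested submodules. -/

section RelativeLength

variable {R : Type*} [CommRing R] {V W : Type*} [AddCommGroup V] [Module R V]
  [AddCommGroup W] [Module R W]

/-- The length of `(N + N') / N'`. -/
def relLength (N N' : Submodule R V) : ℕ∞ := Module.length R (N.map N'.mkQ)

theorem length_map_eq_of_inf_ker_eq (f : V →ₗ[R] W) {V' : Type*} [AddCommGroup V'] [Module R V']
    (g : V →ₗ[R] V') (N : Submodule R V)
    (h : N ⊓ LinearMap.ker f = N ⊓ LinearMap.ker g) :
    Module.length R (N.map f) = Module.length R (N.map g) := by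
  have key : LinearMap.ker (f.domRestrict N) = LinearMap.ker (g.domRestrict N) := by
    ext x
    have := Submodule.ext_iff.mp h x.1
    simpa using this
  have e1 := (f.domRestrict N).quotKerEquivRange
  have e2 := (g.domRestrict N).quotKerEquivRange
  rw [LinearMap.range_domRestrict] at e1 e2
  exact (e1.symm.trans ((Submodule.quotEquivOfEq _ _ key).trans e2)).length_eq

theorem length_map_eq_relLength (f : V →ₗ[R] W) (N N' : Submodule R V)
    (h : N ⊓ LinearMap.ker f = N ⊓ N') : Module.length R (N.map f) = relLength N N' :=
  length_map_eq_of_inf_ker_eq f N'.mkQ N (by rw [Submodule.ker_mkQ, h])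

theorem relLength_congr {N N₁ N₂ : Submodule R V} (h : N ⊓ N₁ = N ⊓ N₂) :
    relLength N N₁ = relLength N N₂ :=
  length_map_eq_relLength _ _ _ (by rw [Submodule.ker_mkQ, h])

theorem relLength_sup_right (N N' : Submodule R V) : relLength (N ⊔ N') N' = relLength N N' := by
  unfold relLength
  rw [Submodule.map_sup, Submodule.mkQ_map_self, sup_bot_eq]

theorem relLength_eq_zero {N N' : Submodule R V} (h : N ≤ N') : relLength N N' = 0 := by
  unfold relLength
  have e : N.map N'.mkQ = ⊥ := by
    rw [eq_bot_iff, Submodule.map_le_iff_le_comap, Submodule.comap_bot, Submodule.ker_mkQ]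
    exact h
  rw [e]
  exact Module.length_bot

theorem relLength_mono_left {N₁ N₂ : Submodule R V} (h : N₁ ≤ N₂) (N : Submodule R V) :
    relLength N₁ N ≤ relLength N₂ N :=
  Module.length_le_of_injective (Submodule.inclusion (Submodule.map_mono h))
    (Submodule.inclusion_injective _)

theorem relLength_anti_right (N : Submodule R V) {N₁ N₂ : Submodule R V} (h : N₁ ≤ N₂) :
    relLength N N₂ ≤ relLength N N₁ := by
  have e : N.map N₂.mkQ = (N.map N₁.mkQ).map (Submodule.factor h) := by
    rw [← Submodule.map_comp]; rfl
  unfold relLength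
  rw [e]
  exact Module.length_le_of_surjective ((Submodule.factor h).submoduleMap (N.map N₁.mkQ))
    (LinearMap.submoduleMap_surjective _ _)

theorem relLength_add {N N' N'' : Submodule R V} (h₁ : N'' ≤ N') (h₂ : N' ≤ N) :
    relLength N N'' = relLength N N' + relLength N' N'' := by
  have e : N.map N'.mkQ = (N.map N''.mkQ).map (Submodule.factor h₁) := by
    rw [← Submodule.map_comp]; rfl
  unfold relLength
  rw [e, add_comm]
  refine Module.length_eq_add_of_exact (Submodule.inclusion (Submodule.map_mono h₂))
    ((Submodule.factor h₁).submoduleMap (N.map N''.mkQ)) (Submodule.inclusion_injective _)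
    (LinearMap.submoduleMap_surjective _ _) ?_
  rintro ⟨y, hy⟩
  obtain ⟨x, hx, rfl⟩ := hy
  constructor
  · intro h
    have h' : N'.mkQ x = 0 := congrArg Subtype.val h
    rw [Submodule.mkQ_apply, Submodule.Quotient.mk_eq_zero] at h'
    exact ⟨⟨N''.mkQ x, x, h', rfl⟩, rfl⟩
  · rintro ⟨⟨z, w, hw, rfl⟩, h⟩
    have h' : N''.mkQ w = N''.mkQ x := congrArg Subtype.val h
    apply Subtype.ext
    change Submodule.factor h₁ (N''.mkQ x) = 0
    rw [← h']
    change N'.mkQ w = 0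
    rw [Submodule.mkQ_apply, Submodule.Quotient.mk_eq_zero]
    exact hw

theorem relLength_map (f : V →ₗ[R] W) (N : Submodule R V) (Q : Submodule R W) :
    relLength (N.map f) Q = relLength N (Q.comap f) := by
  unfold relLength
  rw [← Submodule.map_comp]
  exact length_map_eq_relLength _ _ _ (by rw [LinearMap.ker_comp, Submodule.ker_mkQ])

theorem relLength_map_map_le (f : V →ₗ[R] W) (N N' : Submodule R V) :
    relLength (N.map f) (N'.map f) ≤ relLength N N' := by
  rw [relLength_map]
  exact relLength_anti_right _ (Submodule.le_comap_map _ _)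

theorem relLength_map_map {f : V →ₗ[R] W} (hf : Function.Injective f) (N N' : Submodule R V) :
    relLength (N.map f) (N'.map f) = relLength N N' := by
  rw [relLength_map, Submodule.comap_map_eq_of_injective hf]

theorem relLength_le_add (N N' : Submodule R V) {N'' : Submodule R V} (h : N'' ≤ N') :
    relLength N N'' ≤ relLength N N' + relLength N' N'' := by
  refine (relLength_mono_left (le_sup_left : N ≤ N ⊔ N') N'').trans ?_
  rw [relLength_add h le_sup_right, relLength_sup_right]

theorem relLength_sup_le (N₁ N₂ N : Submodule R V) :
    relLength (N₁ ⊔ N₂) N ≤ relLength N₁ N + relLength N₂ N := by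
  have := relLength_le_add (N₁ ⊔ N₂) (N₂ ⊔ N) (le_sup_right : N ≤ N₂ ⊔ N)
  rw [relLength_sup_right] at this
  refine this.trans (add_le_add_left ?_ _)
  rw [← relLength_sup_right (N₁ ⊔ N₂), sup_assoc, sup_eq_right.mpr
    (le_sup_left : N₂ ≤ N₂ ⊔ N), relLength_sup_right]
  exact relLength_anti_right _ le_sup_right

theorem relLength_finset_sup_le {ι : Type*} (s : Finset ι) (P : ι → Submodule R V)
    (N : Submodule R V) : relLength (s.sup P) N ≤ ∑ i ∈ s, relLength (P i) N := by
  classical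
  induction s using Finset.induction_on with
  | empty => simp [relLength_eq_zero]
  | insert i s hi ih =>
    rw [Finset.sup_insert, Finset.sum_insert hi]
    exact (relLength_sup_le _ _ _).trans (add_le_add_right ih _)

theorem relLength_inf_le (N N₁ N₂ : Submodule R V) :
    relLength N (N₁ ⊓ N₂) ≤ relLength N N₁ + relLength N N₂ := by
  refine (relLength_le_add N (N ⊓ N₁) (N'' := N ⊓ N₁ ⊓ N₂) inf_le_left).trans' ?_ |>.trans ?_
  · exact relLength_anti_right _ (inf_le_inf_right _ inf_le_right)
  · refine add_le_add ?_ ?_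
    · rw [relLength_congr (N := N) (N₁ := N ⊓ N₁) (N₂ := N₁) (by simp)]
    · rw [relLength_congr (N := N ⊓ N₁) (N₁ := N ⊓ N₁ ⊓ N₂) (N₂ := N₂)
        (by ext; simp)]
      exact relLength_mono_left inf_le_left _

theorem relLength_finset_inf_le {ι : Type*} (s : Finset ι) (N : Submodule R V)
    (P : ι → Submodule R V) : relLength N (s.inf P) ≤ ∑ i ∈ s, relLength N (P i) := by
  classical
  induction s using Finset.induction_on with
  | empty => simp [relLength_eq_zero]
  | insert i s hi ih =>
    rw [Finset.inf_insert, Finset.sum_insert hi]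
    exact (relLength_inf_le _ _ _).trans (add_le_add_right ih _)

theorem relLength_top (N : Submodule R V) : relLength ⊤ N = Module.length R (V ⧸ N) := by
  unfold relLength
  rw [Submodule.map_top, Submodule.range_mkQ]
  exact Module.length_top

end RelativeLength

/-! ### Polynomials of bounded degree and a generic element of `𝔪`. -/

section PolynomialCoefficients

open Polynomial

variable {R : Type*} [CommRing R]

/-- The polynomials of degree less than `p` with coefficients in the ideal `L`. -/
def polyIn (p : ℕ) (L : Ideal R) : Submodule R R[X] where
  carrier := {g | ∀ i, g.coeff i ∈ L ∧ (p ≤ i → g.coeff i = 0)}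
  add_mem' := by
    intro f g hf hg i
    refine ⟨by simpa using L.add_mem (hf i).1 (hg i).1, fun h => ?_⟩
    simp [(hf i).2 h, (hg i).2 h]
  zero_mem' := by simp
  smul_mem' := by
    intro r f hf i
    refine ⟨by simpa using L.mul_mem_left r (hf i).1, fun h => ?_⟩
    simp [(hf i).2 h]

theorem polyIn_mono (p : ℕ) {L L' : Ideal R} (h : L ≤ L') : polyIn p L ≤ polyIn p L' :=
  fun _ hg i => ⟨h (hg i).1, (hg i).2⟩

theorem relLength_polyIn (p : ℕ) {L L' : Ideal R} :
    relLength (polyIn p L) (polyIn p L') = p * relLength L L' := by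
  let f : R[X] →ₗ[R] (Fin p → R ⧸ L') :=
    LinearMap.pi fun i => (Submodule.mkQ L').comp (lcoeff R (i : ℕ))
  let h : (Fin p → Submodule.map (Submodule.mkQ L') L) →ₗ[R] (Fin p → R ⧸ L') :=
    LinearMap.pi fun i => (Submodule.map (Submodule.mkQ L') L).subtype.comp (LinearMap.proj i)
  have hinj : Function.Injective h := fun y z hyz =>
    _root_.funext fun i => Subtype.ext (congrFun hyz i)
  rw [← length_map_eq_relLength f]
  · have e : (polyIn p L).map f = LinearMap.range h := by
      ext y
      constructor
      · rintro ⟨g, hg, rfl⟩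
        exact ⟨fun i => ⟨_, g.coeff i, (hg i).1, rfl⟩, rfl⟩
      · rintro ⟨z, rfl⟩
        choose c hc hcz using fun i => (z i).2
        refine ⟨∑ i : Fin p, monomial (i : ℕ) (c i), ?_, ?_⟩
        · intro j
          simp only [finsetSum_coeff, coeff_monomial]
          refine ⟨L.sum_mem fun i _ => ?_, fun h => Finset.sum_eq_zero fun i _ => ?_⟩
          · split_ifs
            exacts [hc i, L.zero_mem]
          · rw [if_neg (by have := i.2; omega)]
        · ext j
          simp only [f, LinearMap.pi_apply, LinearMap.comp_apply, lcoeff_apply, finsetSum_coeff,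
            coeff_monomial]
          rw [Finset.sum_eq_single j]
          · simpa [h] using hcz j
          · intro i _ hij
            rw [if_neg (fun h => hij (Fin.ext h))]
          · simp
    rw [e, ← (LinearEquiv.ofInjective h hinj).length_eq, Module.length_pi_of_fintype]
    simp [relLength]
  · ext g
    simp only [Submodule.mem_inf, LinearMap.mem_ker]
    refine and_congr_right fun hg => ?_
    constructor
    · intro h i
      refine ⟨?_, (hg i).2⟩
      by_cases hi : i < p
      · have := congrFun h ⟨i, hi⟩
        exact (Submodule.Quotient.mk_eq_zero L').mp this
      · rw [(hg i).2 (by omega)]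
        exact L'.zero_mem
    · intro h
      ext i
      exact (Submodule.Quotient.mk_eq_zero L').mpr (h i).1

/-- Multiplication by `ξ` raises degrees by at most `natDegree ξ`. -/
theorem map_mul_polyIn_le (ξ : R[X]) {p : ℕ} {𝔪 L : Ideal R} (hξ : ∀ i, ξ.coeff i ∈ 𝔪) :
    (polyIn p L).map (LinearMap.mulLeft R ξ) ≤ polyIn (p + ξ.natDegree) (𝔪 * L) := by
  rintro _ ⟨g, hg, rfl⟩ i
  rw [LinearMap.mulLeft_apply, coeff_mul]
  refine ⟨Ideal.sum_mem _ fun x _ => Ideal.mul_mem_mul (hξ _) (hg _).1, fun h =>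
    Finset.sum_eq_zero fun x hx => ?_⟩
  rw [Finset.HasAntidiagonal.mem_antidiagonal] at hx
  by_cases h1 : ξ.natDegree < x.1
  · rw [coeff_eq_zero_of_natDegree_lt h1, zero_mul]
  · rw [(hg x.2).2 (by omega), mul_zero]

/-- A quantitative form of McCoy's theorem: for a filtration `N` with `(N (k+1) : 𝔪) ≤ N k` for
`k ≥ k₀`, multiplication by a polynomial `ξ` whose coefficients generate `𝔪` is injective modulo
the filtration. -/
theorem polyIn_of_mul_mem {𝔪 : Ideal R} {ξ : R[X]} (hξ : ∀ i, ξ.coeff i ∈ 𝔪)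
    (hξ' : 𝔪 ≤ Ideal.span (Set.range ξ.coeff)) {N : ℕ → Ideal R} {k₀ : ℕ}
    (hN : ∀ k, 𝔪 * N k ≤ N (k + 1))
    (hcolon : ∀ k ≥ k₀, ∀ z, (∀ w ∈ 𝔪, w * z ∈ N (k + 1)) → z ∈ N k) (p : ℕ) :
    ∀ k ≥ k₀, ∀ g : R[X], (∀ i, p ≤ i → g.coeff i = 0) →
      (∀ i, (ξ * g).coeff i ∈ N (k + 1)) → ∀ i, g.coeff i ∈ N k := by
  induction p with
  | zero =>
    intro k _ g hg _ i
    rw [hg i (Nat.zero_le i)]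
    exact (N k).zero_mem
  | succ p ih =>
    intro k hk g hg hmul
    -- Descending induction on `i`, starting beyond the degree of `ξ`, where the coefficient is
    -- zero.
    have claim : ∀ d i, ξ.natDegree + 1 ≤ i + d → ∀ j, ξ.coeff i * g.coeff j ∈ N (k + 1) := by
      intro d
      induction d with
      | zero =>
        intro i hi j
        rw [coeff_eq_zero_of_natDegree_lt (by omega), zero_mul]
        exact (N _).zero_mem
      | succ d ihd =>
        intro i hi
        -- In the coefficient of index `i + p` of `ξ * g`, every other term has a larger index in
        -- `ξ`, already treated, or an index in `g` beyond `p`, where `g` vanishes.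
        have htop : ξ.coeff i * g.coeff p ∈ N (k + 1) := by
          have h1 := hmul (i + p)
          rw [coeff_mul, ← Finset.add_sum_erase _ _ (a := (i, p)) (by simp)] at h1
          refine ((N (k + 1)).add_mem_iff_left (Ideal.sum_mem _ fun x hx => ?_)).mp h1
          rw [Finset.mem_erase, Finset.HasAntidiagonal.mem_antidiagonal] at hx
          obtain ⟨hne, hsum⟩ := hx
          by_cases h2 : i < x.1
          · exact ihd x.1 (by omega) _
          · have h3 : p + 1 ≤ x.2 := by
              by_contra h4
              exact hne (Prod.ext (by simp; omega) (by simp; omega))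
            rw [hg _ h3, mul_zero]
            exact (N _).zero_mem
        have hcoeff : ∀ j, (C (ξ.coeff i) * (g - monomial p (g.coeff p))).coeff j
            ∈ N (k + 1) := by
          -- The extra factor `ξ.coeff i` raises the filtration by one, so the shorter polynomial is
          -- handled one level deeper. This is why the statement ranges over all `k ≥ k₀`.
          refine ih (k + 1) (by omega) _ (fun j hj => ?_) (fun j => ?_)
          · rw [coeff_C_mul, coeff_sub, coeff_monomial]
            split_ifs with h
            · rw [h, sub_self, mul_zero]
            · rw [hg j (by omega), sub_zero, mul_zero]
          · have e : ξ * (C (ξ.coeff i) * (g - monomial p (g.coeff p)))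
                = C (ξ.coeff i) * (ξ * g) - ξ * monomial p (ξ.coeff i * g.coeff p) := by
              rw [← C_mul_monomial]; ring
            rw [e, coeff_sub, coeff_C_mul]
            refine sub_mem (hN _ (Ideal.mul_mem_mul (hξ i) (hmul j))) ?_
            rw [coeff_mul]
            refine Ideal.sum_mem _ fun x _ => hN _ (Ideal.mul_mem_mul (hξ _) ?_)
            rw [coeff_monomial]
            split_ifs
            exacts [htop, (N _).zero_mem]
        intro j
        have h1 := hcoeff j
        rw [coeff_C_mul, coeff_sub, coeff_monomial] at h1
        split_ifs at h1 with h
        · rw [← h]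
          exact htop
        · rwa [sub_zero] at h1
    intro j
    refine hcolon k hk _ fun w hw => ?_
    refine Submodule.span_induction (p := fun w _ => w * g.coeff j ∈ N (k + 1)) ?_ ?_ ?_ ?_ (hξ' hw)
    · rintro _ ⟨i, rfl⟩
      exact claim (ξ.natDegree + 1) i (by omega) j
    · simp
    · intro x y _ _ hx hy
      rw [add_mul]
      exact add_mem hx hy
    · intro a x _ hx
      rw [smul_eq_mul, mul_assoc]
      exact Ideal.mul_mem_left _ _ hx

/-- Supplies the substitute for a general element of `𝔪`: generators become the coefficients. -/
theorem exists_polynomial_span_coeff_eq {𝔪 : Ideal R} (h : 𝔪.FG) :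
    ∃ ξ : R[X], Ideal.span (Set.range ξ.coeff) = 𝔪 := by
  obtain ⟨n, x, hx⟩ := Submodule.fg_iff_exists_fin_generating_family.mp h
  refine ⟨∑ i : Fin n, monomial (i : ℕ) (x i), ?_⟩
  have hc : ∀ i : Fin n, (∑ i : Fin n, monomial (i : ℕ) (x i)).coeff i = x i := by
    intro i
    simp only [finsetSum_coeff, coeff_monomial]
    rw [Finset.sum_eq_single i]
    · simp
    · intro j _ hij
      rw [if_neg (fun h => hij (Fin.ext h))]
    · simp
  refine le_antisymm (Ideal.span_le.mpr ?_) ?_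
  · rintro _ ⟨j, rfl⟩
    simp only [finsetSum_coeff, coeff_monomial, SetLike.mem_coe]
    refine Ideal.sum_mem _ fun i _ => ?_
    split_ifs
    · rw [← hx]
      exact Submodule.subset_span ⟨i, rfl⟩
    · exact Ideal.zero_mem _
  · rw [← hx]
    refine Submodule.span_le.mpr ?_
    rintro _ ⟨i, rfl⟩
    exact Ideal.subset_span ⟨i, hc i⟩

end PolynomialCoefficients

end

noncomputable section

/-! ### Stability of colons of powers, by Artin–Rees. -/

section Colon

variable {R : Type*} [CommRing R]

/-- Multiplication by a nonzerodivisor maps an ideal `L` to `y L`. -/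
theorem map_mulLeft_eq_span_mul (y : R) (L : Ideal R) :
    Submodule.map (LinearMap.mulLeft R y) L = Ideal.span {y} * L := by
  ext z
  rw [Ideal.mem_span_singleton_mul]
  rfl

theorem mul_mem_span_singleton_mul_iff {y : R} (hy : y ∈ nonZeroDivisors R) {L : Ideal R} {z : R} :
    y * z ∈ Ideal.span {y} * L ↔ z ∈ L := by
  rw [Ideal.mem_span_singleton_mul]
  constructor
  · rintro ⟨w, hw, h⟩
    rwa [← (mul_cancel_left_mem_nonZeroDivisors hy).mp h]
  · exact fun h => ⟨z, h, rfl⟩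

theorem mulLeft_injective_of_mem_nonZeroDivisors {y : R} (hy : y ∈ nonZeroDivisors R) :
    Function.Injective (LinearMap.mulLeft R y) :=
  fun _ _ h => (mul_cancel_left_mem_nonZeroDivisors hy).mp h

/-- Artin–Rees for `(y) ⊆ R`, followed by cancellation of `y`. -/
theorem exists_mem_pow_sub_of_mul_mem_pow [IsNoetherianRing R] (𝔪 : Ideal R) {y : R}
    (hy : y ∈ nonZeroDivisors R) :
    ∃ c, ∀ k z, y * z ∈ 𝔪 ^ k → z ∈ 𝔪 ^ (k - c) := by
  obtain ⟨c, hc⟩ := 𝔪.exists_pow_inf_eq_pow_smul (M := R) (Ideal.span {y})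
  refine ⟨c, fun k z hz => ?_⟩
  by_cases hk : c ≤ k
  · have h1 : y * z ∈ 𝔪 ^ k • (⊤ : Submodule R R) ⊓ Ideal.span {y} := by
      refine Submodule.mem_inf.mpr ⟨?_, Ideal.mul_mem_right _ _ (Ideal.mem_span_singleton_self y)⟩
      rw [smul_eq_mul, Ideal.mul_top]
      exact hz
    rw [hc _ hk, smul_eq_mul] at h1
    have h2 : y * z ∈ Ideal.span {y} * 𝔪 ^ (k - c) := by
      rw [mul_comm (Ideal.span {y})]
      exact Ideal.mul_mono_right inf_le_right h1
    exact (mul_mem_span_singleton_mul_iff hy).mp h2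
  · rw [Nat.sub_eq_zero_of_le (by omega), pow_zero, Ideal.one_eq_top]
    trivial

/-- If `𝔪` contains a nonzerodivisor, then `(𝔪^(k+1) M : 𝔪) = 𝔪^k M` for large `k`. -/
theorem exists_colon_pow_mul_le [IsNoetherianRing R] {𝔪 : Ideal R} {y : R}
    (hy : y ∈ nonZeroDivisors R) (hym : y ∈ 𝔪) (M : Ideal R) :
    ∃ k₀, ∀ k ≥ k₀, ∀ z, (∀ w ∈ 𝔪, w * z ∈ 𝔪 ^ (k + 1) * M) → z ∈ 𝔪 ^ k * M := by
  let F' : 𝔪.Filtration R :=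
    { N := fun k =>
        { carrier := {z | ∀ w ∈ 𝔪, w * z ∈ 𝔪 ^ (k + 1) * M}
          add_mem' := fun {a b} ha hb w hw => by
            rw [mul_add]
            exact add_mem (ha w hw) (hb w hw)
          zero_mem' := fun w _ => by simp
          smul_mem' := fun r z hz w hw => by
            rw [smul_eq_mul, mul_left_comm]
            exact Ideal.mul_mem_left _ r (hz w hw) }
      mono := fun k z hz w hw => Ideal.mul_mono_left (Ideal.pow_le_pow_right (by omega)) (hz w hw)
      smul_le := fun k => Submodule.smul_le.mpr fun r hr z hz w hw => by
        have h : r * (w * z) ∈ 𝔪 * (𝔪 ^ (k + 1) * M) := Ideal.mul_mem_mul hr (hz w hw)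
        rwa [← mul_assoc, ← pow_succ', mul_left_comm] at h }
  obtain ⟨c, hc⟩ := exists_mem_pow_sub_of_mul_mem_pow 𝔪 hy
  let F : 𝔪.Filtration R :=
    { N := fun k => 𝔪 ^ (k + 1 - c)
      mono := fun k => Ideal.pow_le_pow_right (by omega)
      smul_le := fun k => by
        rw [smul_eq_mul, ← pow_succ']
        exact Ideal.pow_le_pow_right (by omega) }
  have hF : F.Stable := ⟨c, fun n hn => by
    change 𝔪 • 𝔪 ^ (n + 1 - c) = 𝔪 ^ (n + 1 + 1 - c)
    rw [smul_eq_mul, ← pow_succ']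
    congr 1
    omega⟩
  -- Testing with `w = y` bounds the colon filtration by shifted powers of `𝔪`. A filtration below a
  -- stable one is stable, by Artin–Rees.
  have hle : F' ≤ F := by
    intro k z hz
    have hz' : ∀ w ∈ 𝔪, w * z ∈ 𝔪 ^ (k + 1) * M := hz
    have h : y * z ∈ 𝔪 ^ (k + 1) := Ideal.mul_le_left (hz' y hym)
    exact hc (k + 1) z h
  obtain ⟨n₀, hn₀⟩ := hF.of_le hle
  -- Stability at `k - 1` writes `z` as an element of `𝔪 · F'.N (k - 1)`, which lies in `𝔪ᵏ M` by
  -- the definition of the colon.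
  refine ⟨n₀ + 1, fun k hk z hz => ?_⟩
  obtain ⟨n, rfl⟩ : ∃ n, k = n + 1 := ⟨k - 1, by omega⟩
  have hz' : z ∈ F'.N (n + 1) := hz
  rw [← hn₀ n (by omega)] at hz'
  refine Submodule.smul_le.mpr (fun r hr w hw => ?_) hz'
  exact hw r hr

end Colon

theorem ENat.mul_ne_top_of_ne_top {a b : ℕ∞} (ha : a ≠ ⊤) (hb : b ≠ ⊤) : a * b ≠ ⊤ :=
  WithTop.mul_ne_top ha hb

/-- The passage from polynomials back to `R`: an error independent of `p` does not affect lengths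
that scale with `p`. -/
theorem ENat.le_of_forall_nat_mul_le {A A' C : ℕ∞} (hC : C ≠ ⊤)
    (h : ∀ p : ℕ, p * A ≤ p * A' + C) : A ≤ A' := by
  lift C to ℕ using hC
  induction A' with
  | top => exact le_top
  | coe a' =>
    induction A with
    | top => simpa using h 1
    | coe a =>
      have := h (C + 1)
      norm_cast at this ⊢
      by_contra! hlt
      nlinarith

/-! ### Growth of Hilbert functions via multiplication by `ξ`. -/

section HilbertFunction

open Polynomial

variable {R : Type*} [CommRing R] {𝔪 : Ideal R} {ξ : R[X]} {N : ℕ → Ideal R}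

/-- By `polyIn_of_mul_mem`, the polynomials that `ξ` sends into `N (k + 1)` are exactly those with
coefficients in `N k`, so nothing else is lost under multiplication. -/
theorem relLength_map_mulLeft_polyIn (hξ : Ideal.span (Set.range ξ.coeff) = 𝔪)
    (hN : ∀ k, N (k + 1) = 𝔪 * N k) {k₀ : ℕ}
    (hcolon : ∀ k ≥ k₀, ∀ z, (∀ w ∈ 𝔪, w * z ∈ N (k + 1)) → z ∈ N k) {k : ℕ} (hk : k₀ ≤ k)
    (p : ℕ) (L : Ideal R) :
    relLength ((polyIn p L).map (LinearMap.mulLeft R ξ)) (polyIn (p + ξ.natDegree) (N (k + 1)))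
      = p * relLength L (N k) := by
  have hξ' : ∀ i, ξ.coeff i ∈ 𝔪 := fun i => hξ ▸ Ideal.subset_span ⟨i, rfl⟩
  rw [relLength_map, ← relLength_polyIn]
  refine relLength_congr ?_
  ext g
  simp only [Submodule.mem_inf, Submodule.mem_comap]
  refine and_congr_right fun hg => ⟨fun h i => ⟨?_, (hg i).2⟩, fun h => ?_⟩
  · exact polyIn_of_mul_mem hξ' hξ.ge (fun k => (hN k).ge) hcolon p k hk g (fun i => (hg i).2)
      (fun i => (h i).1) i
  · rw [hN k]
    exact map_mul_polyIn_le ξ hξ' ⟨g, h, rfl⟩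

theorem filtration_antitone (hN : ∀ k, N (k + 1) = 𝔪 * N k) : Antitone N :=
  antitone_nat_of_succ_le fun k => (hN k).trans_le Ideal.mul_le_right

/-- Multiplication by `ξ` embeds polynomials over `N 0 / N k` into polynomials over `N 1 / N (k +
1)`. The error comes from the `natDegree ξ` additional degrees of the target. -/
theorem relLength_le_relLength_succ (hξ : Ideal.span (Set.range ξ.coeff) = 𝔪)
    (hN : ∀ k, N (k + 1) = 𝔪 * N k) {k₀ : ℕ}
    (hcolon : ∀ k ≥ k₀, ∀ z, (∀ w ∈ 𝔪, w * z ∈ N (k + 1)) → z ∈ N k)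
    (hfin : ∀ k, relLength (N 0) (N k) ≠ ⊤) {k : ℕ} (hk : k₀ ≤ k) :
    relLength (N 0) (N k) ≤ relLength (N 1) (N (k + 1)) := by
  have hξ' : ∀ i, ξ.coeff i ∈ 𝔪 := fun i => hξ ▸ Ideal.subset_span ⟨i, rfl⟩
  have hfin1 : relLength (N 1) (N (k + 1)) ≠ ⊤ :=
    ne_top_of_le_ne_top (hfin (k + 1))
      (relLength_mono_left (filtration_antitone hN (Nat.zero_le 1)) _)
  refine ENat.le_of_forall_nat_mul_le (C := ξ.natDegree * relLength (N 1) (N (k + 1)))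
    (ENat.mul_ne_top_of_ne_top (ENat.natCast_ne_top _) hfin1) fun p => ?_
  rw [← relLength_map_mulLeft_polyIn hξ hN hcolon hk p (N 0), ← add_mul, ← Nat.cast_add,
    ← relLength_polyIn, hN 0]
  exact relLength_mono_left (map_mul_polyIn_le ξ hξ') _

/-- The Hilbert function of a module of depth one is bounded by its eventual values. -/
theorem relLength_zero_one_le (hξ : Ideal.span (Set.range ξ.coeff) = 𝔪)
    (hN : ∀ k, N (k + 1) = 𝔪 * N k) {k₀ : ℕ}
    (hcolon : ∀ k ≥ k₀, ∀ z, (∀ w ∈ 𝔪, w * z ∈ N (k + 1)) → z ∈ N k)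
    (hfin : ∀ k, relLength (N 0) (N k) ≠ ⊤) {k : ℕ} (hk : k₀ ≤ k) :
    relLength (N 0) (N 1) ≤ relLength (N k) (N (k + 1)) := by
  have hanti := filtration_antitone hN
  have h := relLength_le_relLength_succ hξ hN hcolon hfin hk
  have e1 := relLength_add (hanti (by omega : 1 ≤ k + 1)) (hanti (Nat.zero_le 1))
  have e2 := relLength_add (hanti (Nat.le_succ k)) (hanti (Nat.zero_le k))
  rw [e1] at e2
  have h1 := hfin k
  refine (ENat.add_le_add_iff_left h1).mp ?_
  rw [← Nat.succ_eq_add_one k, ← e2, add_comm]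
  gcongr

/-- If the Hilbert function already attains its eventual value at `0`, then `ξ N₀` is almost all
of `N₁`. -/
theorem exists_relLength_polyIn_le (hξ : Ideal.span (Set.range ξ.coeff) = 𝔪)
    (hN : ∀ k, N (k + 1) = 𝔪 * N k) {k₀ : ℕ}
    (hcolon : ∀ k ≥ k₀, ∀ z, (∀ w ∈ 𝔪, w * z ∈ N (k + 1)) → z ∈ N k)
    (hfin : ∀ k, relLength (N 0) (N k) ≠ ⊤) {k : ℕ} (hk : k₀ ≤ k)
    (heq : relLength (N 0) (N 1) = relLength (N k) (N (k + 1))) :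
    ∃ C : ℕ, ∀ p, relLength (polyIn (p + ξ.natDegree) (N 1))
      ((polyIn p (N 0)).map (LinearMap.mulLeft R ξ) ⊔ polyIn (p + ξ.natDegree) (N (k + 1))) ≤ C := by
  have hξ' : ∀ i, ξ.coeff i ∈ 𝔪 := fun i => hξ ▸ Ideal.subset_span ⟨i, rfl⟩
  have hanti := filtration_antitone hN
  have e1 := relLength_add (hanti (by omega : 1 ≤ k + 1)) (hanti (Nat.zero_le 1))
  have e2 := relLength_add (hanti (Nat.le_succ k)) (hanti (Nat.zero_le k))
  have hh : relLength (N 1) (N (k + 1)) = relLength (N 0) (N k) := by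
    have h1 := hfin 1
    refine ENat.add_right_injective_of_ne_top h1 ?_
    change _ + _ = _ + _
    rw [← e1, e2, add_comm, heq]
  obtain ⟨c, hc⟩ := ENat.ne_top_iff_exists.mp (hfin k)
  refine ⟨ξ.natDegree * c, fun p => ?_⟩
  have e3 := relLength_add (N := polyIn (p + ξ.natDegree) (N 1))
    (N' := (polyIn p (N 0)).map (LinearMap.mulLeft R ξ) ⊔ polyIn (p + ξ.natDegree) (N (k + 1)))
    (N'' := polyIn (p + ξ.natDegree) (N (k + 1))) le_sup_right
    (sup_le ((map_mul_polyIn_le ξ hξ').trans_eq (by rw [hN 0]))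
      (polyIn_mono _ (hanti (by omega))))
  rw [relLength_sup_right, relLength_map_mulLeft_polyIn hξ hN hcolon hk, relLength_polyIn, hh,
    ← hc] at e3
  generalize relLength (polyIn (p + ξ.natDegree) (N 1))
    ((polyIn p (N 0)).map (LinearMap.mulLeft R ξ) ⊔ polyIn (p + ξ.natDegree) (N (k + 1))) = X
    at e3 ⊢
  induction X with
  | top =>
    rw [top_add] at e3
    exact absurd e3 (by norm_cast)
  | coe x =>
    norm_cast at e3 ⊢
    rw [add_mul] at e3
    omega

end HilbertFunction

end

noncomputable section

/-! ### Consequences of an extremal Hilbert function. -/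

section NearReduction

open Polynomial

variable {R : Type*} [CommRing R] {𝔪 : Ideal R} {ξ : R[X]} {N : ℕ → Ideal R}

theorem relLength_le_of_inf_le {V : Type*} [AddCommGroup V] [Module R V] {N N₁ N₂ : Submodule R V}
    (h : N ⊓ N₁ ≤ N₂) : relLength N N₂ ≤ relLength N N₁ := by
  rw [relLength_congr (N := N) (N₁ := N₁) (N₂ := N ⊓ N₁) (by simp)]
  exact relLength_anti_right _ h

theorem exists_sum_coeff_mul_of_mem_mul (hξ : Ideal.span (Set.range ξ.coeff) = 𝔪) {L : Ideal R}
    {z : R} (hz : z ∈ 𝔪 * L) :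
    ∃ l : ℕ → R, (∀ i, l i ∈ L) ∧ z = ∑ i ∈ Finset.range (ξ.natDegree + 1), ξ.coeff i * l i := by
  refine Submodule.mul_induction_on hz (fun r hr s hs => ?_) (fun x y hx hy => ?_)
  · rw [← hξ] at hr
    refine Submodule.span_induction (p := fun r _ => ∃ l : ℕ → R, (∀ i, l i ∈ L) ∧
      r * s = ∑ i ∈ Finset.range (ξ.natDegree + 1), ξ.coeff i * l i) ?_ ?_ ?_ ?_ hr
    · rintro _ ⟨i, rfl⟩
      refine ⟨fun j => if j = i then s else 0, fun j => ?_, ?_⟩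
      · beta_reduce
        split_ifs
        exacts [hs, L.zero_mem]
      · simp only [mul_ite, mul_zero, Finset.sum_ite_eq', Finset.mem_range]
        split_ifs with h
        · rfl
        · rw [coeff_eq_zero_of_natDegree_lt (by omega), zero_mul]
    · exact ⟨fun _ => 0, fun _ => L.zero_mem, by simp⟩
    · rintro x y _ _ ⟨l, hl, hx⟩ ⟨l', hl', hy⟩
      refine ⟨fun i => l i + l' i, fun i => add_mem (hl i) (hl' i), ?_⟩
      simp only [mul_add, Finset.sum_add_distrib, add_mul, hx, hy]
    · rintro a x _ ⟨l, hl, hx⟩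
      refine ⟨fun i => a * l i, fun i => L.mul_mem_left a (hl i), ?_⟩
      rw [smul_eq_mul, mul_assoc, hx, Finset.mul_sum]
      exact Finset.sum_congr rfl fun i _ => by ring
  · obtain ⟨l, hl, hx⟩ := hx
    obtain ⟨l', hl', hy⟩ := hy
    refine ⟨fun i => l i + l' i, fun i => add_mem (hl i) (hl' i), ?_⟩
    simp only [mul_add, Finset.sum_add_distrib, hx, hy]

theorem polyIn_mul_le_sup (hξ : Ideal.span (Set.range ξ.coeff) = 𝔪) (q : ℕ) (L : Ideal R) :
    polyIn q (𝔪 * L) ≤ (Finset.range (ξ.natDegree + 1)).sup fun i =>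
      (polyIn q L).map (LinearMap.mulLeft R (C (ξ.coeff i))) := by
  intro g hg
  choose l hl hgl using fun j => exists_sum_coeff_mul_of_mem_mul hξ (hg j).1
  have e : g = ∑ i ∈ Finset.range (ξ.natDegree + 1),
      C (ξ.coeff i) * ∑ j ∈ Finset.range q, monomial j (l j i) := by
    ext j
    simp only [finsetSum_coeff, coeff_C_mul, coeff_monomial, Finset.sum_ite_eq',
      Finset.mem_range]
    by_cases hj : j < q
    · simp only [if_pos hj]
      exact hgl j
    · simp [if_neg hj, (hg j).2 (by omega)]
  rw [e]
  refine Submodule.sum_mem _ fun i hi => ?_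
  refine Finset.le_sup (f := fun i => (polyIn q L).map (LinearMap.mulLeft R (C (ξ.coeff i)))) hi ?_
  refine ⟨_, fun j => ?_, rfl⟩
  simp only [finsetSum_coeff, coeff_monomial, Finset.sum_ite_eq', Finset.mem_range]
  refine ⟨?_, fun h => by rw [if_neg (by omega)]⟩
  split_ifs
  exacts [hl _ _, L.zero_mem]

theorem polyIn_span_singleton_mul_le (q : ℕ) (y : R) (L : Ideal R) :
    polyIn q (Ideal.span {y} * L) ≤ (polyIn q L).map (LinearMap.mulLeft R (C y)) := by
  intro g hg
  choose l hl hgl using fun j => Ideal.mem_span_singleton_mul.mp (hg j).1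
  refine ⟨∑ j ∈ Finset.range q, monomial j (l j), fun j => ?_, ?_⟩
  · simp only [finsetSum_coeff, coeff_monomial, Finset.sum_ite_eq', Finset.mem_range]
    refine ⟨?_, fun h => by rw [if_neg (by omega)]⟩
    split_ifs
    exacts [hl _, L.zero_mem]
  · ext j
    simp only [LinearMap.mulLeft_apply, finsetSum_coeff, coeff_C_mul, coeff_monomial,
      Finset.sum_ite_eq', Finset.mem_range]
    split_ifs with h
    · exact hgl j
    · rw [mul_zero, (hg j).2 (by omega)]

theorem map_C_mul_polyIn_le {r : R} {q : ℕ} {L L' : Ideal R} (h : ∀ z ∈ L, r * z ∈ L') :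
    (polyIn q L).map (LinearMap.mulLeft R (C r)) ≤ polyIn q L' := by
  rintro _ ⟨g, hg, rfl⟩ i
  rw [LinearMap.mulLeft_apply, coeff_C_mul]
  exact ⟨h _ (hg i).1, fun hi => by rw [(hg i).2 hi, mul_zero]⟩

theorem map_mulLeft_comm (f g : R[X]) (P : Submodule R R[X]) :
    (P.map (LinearMap.mulLeft R f)).map (LinearMap.mulLeft R g) =
      (P.map (LinearMap.mulLeft R g)).map (LinearMap.mulLeft R f) := by
  rw [← Submodule.map_comp, ← Submodule.map_comp, ← LinearMap.mulLeft_mul,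
    ← LinearMap.mulLeft_mul, mul_comm]

/-- If `N 1` is `ξ N 0` up to a bounded length, then multiplying by `𝔪` shows the same of `N 2` and
`ξ N 1`; so `ℓ(N 2 / N (k + 2)) ≤ ℓ(N 1 / N (k + 1))`, and additivity of length gives the claim. -/
theorem relLength_succ_le_relLength_one (hξ : Ideal.span (Set.range ξ.coeff) = 𝔪)
    (hN : ∀ k, N (k + 1) = 𝔪 * N k) {k₀ : ℕ}
    (hcolon : ∀ k ≥ k₀, ∀ z, (∀ w ∈ 𝔪, w * z ∈ N (k + 1)) → z ∈ N k)
    (hfin : ∀ k, relLength (N 0) (N k) ≠ ⊤) {k : ℕ} (hk : k₀ ≤ k)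
    (heq : relLength (N 0) (N 1) = relLength (N k) (N (k + 1))) :
    relLength (N (k + 1)) (N (k + 2)) ≤ relLength (N 1) (N 2) := by
  obtain ⟨C', hC⟩ := exists_relLength_polyIn_le hξ hN hcolon hfin hk heq
  have hξ' : ∀ i, ξ.coeff i ∈ 𝔪 := fun i => hξ ▸ Ideal.subset_span ⟨i, rfl⟩
  have hanti := filtration_antitone hN
  have hmul : ∀ i j, ∀ z ∈ N j, ξ.coeff i * z ∈ N (j + 1) := fun i j z hz => by
    rw [hN]
    exact Ideal.mul_mem_mul (hξ' i) hz
  have key : relLength (N 2) (N (k + 2)) ≤ relLength (N 1) (N (k + 1)) := by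
    refine ENat.le_of_forall_nat_mul_le (C := ((ξ.natDegree + 1) * C' : ℕ))
      (ENat.natCast_ne_top _) fun p => ?_
    set S := (polyIn p (N 1)).map (LinearMap.mulLeft R ξ) ⊔ polyIn (p + ξ.natDegree) (N (k + 2))
    -- Over polynomials, `N 2` is covered by the `natDegree ξ + 1` multiples of `N 1` by
    -- coefficients of `ξ`. Each is within `C'` of a multiple of `ξ N 0`, which lies in `ξ N 1`.
    have h1 : relLength (polyIn (p + ξ.natDegree) (N 2)) S ≤ ((ξ.natDegree + 1) * C' : ℕ) := by
      rw [hN 1]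
      refine (relLength_mono_left (polyIn_mul_le_sup hξ _ _) _).trans ?_
      refine (relLength_finset_sup_le _ _ _).trans ?_
      refine (Finset.sum_le_card_nsmul _ _ (C' : ℕ∞) fun i _ => ?_).trans (by simp)
      refine le_trans (relLength_anti_right _ ?_) ((relLength_map_map_le _ _ _).trans (hC p))
      rw [Submodule.map_sup, map_mulLeft_comm]
      exact sup_le_sup (Submodule.map_mono (map_C_mul_polyIn_le (hmul i 0)))
        (map_C_mul_polyIn_le (hmul i (k + 1)))
    calc (p : ℕ∞) * relLength (N 2) (N (k + 2))
        ≤ ((p + ξ.natDegree : ℕ) : ℕ∞) * relLength (N 2) (N (k + 2)) := by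
          gcongr
          omega
      _ = relLength (polyIn (p + ξ.natDegree) (N 2)) (polyIn (p + ξ.natDegree) (N (k + 2))) :=
          (relLength_polyIn _).symm
      _ ≤ relLength (polyIn (p + ξ.natDegree) (N 2)) S
          + relLength S (polyIn (p + ξ.natDegree) (N (k + 2))) :=
          relLength_le_add _ _ le_sup_right
      _ ≤ ((ξ.natDegree + 1) * C' : ℕ) + p * relLength (N 1) (N (k + 1)) := by
          refine add_le_add h1 ?_
          rw [relLength_sup_right, relLength_map_mulLeft_polyIn hξ hN hcolon (by omega)]
      _ = _ := add_comm _ _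
  have e1 := relLength_add (hanti (by omega : 2 ≤ k + 2)) (hanti (by omega : 1 ≤ 2))
  have e2 := relLength_add (hanti (by omega : k + 1 ≤ k + 2)) (hanti (by omega : 1 ≤ k + 1))
  have hfin1 : relLength (N 1) (N (k + 1)) ≠ ⊤ :=
    ne_top_of_le_ne_top (hfin (k + 1)) (relLength_mono_left (hanti (Nat.zero_le 1)) _)
  refine (ENat.add_le_add_iff_left hfin1).mp ?_
  rw [← e2, e1, add_comm]
  gcongr

/-- Modulo `Y`, the kernel and cokernel of multiplication by `ξ` have equal length, up to the shift
in degree. As `Y ⊆ 𝔪²`, the cokernel surjects onto the cokernel modulo `𝔪²`. There multiplication by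
`ξ` kills `𝔪`, so at least `ℓ(R/𝔪²) - ℓ(R/𝔪) = ℓ(𝔪/𝔪²)` survives per degree. -/
theorem mul_relLength_le_relLength_comap (hξ : Ideal.span (Set.range ξ.coeff) = 𝔪)
    (hfin : ∀ k, relLength ⊤ (𝔪 ^ k) ≠ ⊤) {Y : Ideal R} (hYle : Y ≤ 𝔪 ^ 2)
    (hfiny : relLength ⊤ Y ≠ ⊤) (p : ℕ) :
    p * relLength 𝔪 (𝔪 ^ 2) ≤
      relLength (polyIn p (⊤ : Ideal R) ⊓
        (polyIn (p + ξ.natDegree) Y).comap (LinearMap.mulLeft R ξ)) (polyIn p Y)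
      + ξ.natDegree * relLength ⊤ Y := by
  have hξ' : ∀ i, ξ.coeff i ∈ 𝔪 := fun i => hξ ▸ Ideal.subset_span ⟨i, rfl⟩
  have h2le : 𝔪 ^ 2 ≤ 𝔪 := Ideal.pow_le_self two_ne_zero
  set d := ξ.natDegree with hd
  set U := polyIn p (⊤ : Ideal R) ⊓ (polyIn (p + d) Y).comap (LinearMap.mulLeft R ξ) with hU
  have hYU : polyIn p Y ≤ U := le_inf (polyIn_mono _ le_top) <| Submodule.map_le_iff_le_comap.mp
    ((map_mul_polyIn_le ξ hξ').trans (polyIn_mono _ Ideal.mul_le_right))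
  have e1 := relLength_add hYU (inf_le_left : U ≤ polyIn p (⊤ : Ideal R))
  have hmapU : relLength (polyIn p (⊤ : Ideal R)) U =
      relLength ((polyIn p (⊤ : Ideal R)).map (LinearMap.mulLeft R ξ)) (polyIn (p + d) Y) := by
    rw [relLength_map]
    exact relLength_congr (by simp [hU])
  rw [hmapU, relLength_polyIn] at e1
  have hmap_top : (polyIn p (⊤ : Ideal R)).map (LinearMap.mulLeft R ξ) ≤
      polyIn (p + d) (⊤ : Ideal R) := (map_mul_polyIn_le ξ hξ').trans (polyIn_mono _ le_top)
  have e2 := relLength_add (N := polyIn (p + d) (⊤ : Ideal R))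
    (N' := (polyIn p (⊤ : Ideal R)).map (LinearMap.mulLeft R ξ) ⊔ polyIn (p + d) Y)
    le_sup_right (sup_le hmap_top (polyIn_mono _ le_top))
  have e3 := relLength_add (N := polyIn (p + d) (⊤ : Ideal R))
    (N' := (polyIn p (⊤ : Ideal R)).map (LinearMap.mulLeft R ξ) ⊔ polyIn (p + d) (𝔪 ^ 2))
    le_sup_right (sup_le hmap_top (polyIn_mono _ le_top))
  have e4 : relLength (polyIn (p + d) (⊤ : Ideal R))
        ((polyIn p (⊤ : Ideal R)).map (LinearMap.mulLeft R ξ) ⊔ polyIn (p + d) (𝔪 ^ 2)) ≤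
      relLength (polyIn (p + d) (⊤ : Ideal R))
        ((polyIn p (⊤ : Ideal R)).map (LinearMap.mulLeft R ξ) ⊔ polyIn (p + d) Y) :=
    relLength_anti_right _ (sup_le_sup_left (polyIn_mono _ hYle) _)
  have e5 : relLength ((polyIn p (⊤ : Ideal R)).map (LinearMap.mulLeft R ξ))
      (polyIn (p + d) (𝔪 ^ 2)) ≤ p * relLength ⊤ 𝔪 := by
    rw [relLength_map, ← relLength_polyIn]
    refine relLength_anti_right _ (Submodule.map_le_iff_le_comap.mp ?_)
    rw [pow_two]
    exact map_mul_polyIn_le ξ hξ'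
  have e6 := relLength_add h2le (le_top : 𝔪 ≤ ⊤)
  rw [relLength_sup_right, relLength_polyIn] at e2 e3
  have f1 := hfin 1
  have f2 := hfin 2
  rw [pow_one] at f1
  have f3 : relLength 𝔪 (𝔪 ^ 2) ≠ ⊤ := ne_top_of_le_ne_top f2 (relLength_mono_left le_top _)
  have f4 : relLength U (polyIn p Y) ≠ ⊤ := by
    refine ne_top_of_le_ne_top (ENat.mul_ne_top_of_ne_top (ENat.natCast_ne_top p) hfiny) ?_
    rw [e1]
    exact le_add_self
  have f5 : relLength ((polyIn p (⊤ : Ideal R)).map (LinearMap.mulLeft R ξ))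
      (polyIn (p + d) Y) ≠ ⊤ := by
    refine ne_top_of_le_ne_top (ENat.mul_ne_top_of_ne_top (ENat.natCast_ne_top p) hfiny) ?_
    rw [e1]
    exact le_self_add
  have f6 : relLength (polyIn (p + d) (⊤ : Ideal R))
        ((polyIn p (⊤ : Ideal R)).map (LinearMap.mulLeft R ξ) ⊔ polyIn (p + d) Y) ≠ ⊤ := by
    refine ne_top_of_le_ne_top (ENat.mul_ne_top_of_ne_top (ENat.natCast_ne_top (p + d)) hfiny) ?_
    rw [e2]
    exact le_self_add
  have f7 := ne_top_of_le_ne_top f6 e4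
  have f8 := ne_top_of_le_ne_top
    (ENat.mul_ne_top_of_ne_top (ENat.natCast_ne_top p) f1) e5
  rw [e6] at e3
  generalize relLength (⊤ : Ideal R) 𝔪 = c0 at *
  generalize relLength 𝔪 (𝔪 ^ 2) = e at *
  generalize relLength (⊤ : Ideal R) Y = G at *
  generalize relLength U (polyIn p Y) = u at *
  generalize relLength ((polyIn p (⊤ : Ideal R)).map (LinearMap.mulLeft R ξ))
      (polyIn (p + d) Y) = A at *
  generalize relLength (polyIn (p + d) (⊤ : Ideal R))
    ((polyIn p (⊤ : Ideal R)).map (LinearMap.mulLeft R ξ) ⊔ polyIn (p + d) Y) = B at *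
  generalize relLength (polyIn (p + d) (⊤ : Ideal R))
    ((polyIn p (⊤ : Ideal R)).map (LinearMap.mulLeft R ξ) ⊔ polyIn (p + d) (𝔪 ^ 2)) = B' at *
  generalize relLength ((polyIn p (⊤ : Ideal R)).map (LinearMap.mulLeft R ξ))
      (polyIn (p + d) (𝔪 ^ 2)) = c at *
  lift c0 to ℕ using f1
  lift e to ℕ using f3
  lift G to ℕ using hfiny
  lift u to ℕ using f4
  lift A to ℕ using f5
  lift B to ℕ using f6
  lift B' to ℕ using f7
  lift c to ℕ using f8
  norm_cast at *
  have := Nat.zero_le (d * (c0 + e))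
  linarith

/-- If the embedding dimension attains the eventual value of the Hilbert function, then it is at
most the length of `(y𝔪 : 𝔪) / y𝔪`. -/
theorem relLength_le_relLength_colon (hξ : Ideal.span (Set.range ξ.coeff) = 𝔪) {y : R}
    (hym : y ∈ 𝔪) {k₀ : ℕ}
    (hcolon : ∀ k ≥ k₀, ∀ z, (∀ w ∈ 𝔪, w * z ∈ 𝔪 ^ (k + 1 + 1)) → z ∈ 𝔪 ^ (k + 1))
    (hcolon' : ∀ k ≥ k₀, ∀ z,
      (∀ w ∈ 𝔪, w * z ∈ 𝔪 ^ (k + 1) * Ideal.span {y}) → z ∈ 𝔪 ^ k * Ideal.span {y})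
    (hfin : ∀ k, relLength ⊤ (𝔪 ^ k) ≠ ⊤) (hfiny : relLength ⊤ (𝔪 * Ideal.span {y}) ≠ ⊤)
    {k : ℕ} (hk : k₀ ≤ k)
    (heq : relLength 𝔪 (𝔪 ^ 2) = relLength (𝔪 ^ (k + 1)) (𝔪 ^ (k + 2))) {D : Ideal R}
    (hD : ∀ z, (∀ w ∈ 𝔪, w * z ∈ 𝔪 * Ideal.span {y}) → z ∈ D)
    (hD' : 𝔪 * Ideal.span {y} ≤ D) :
    relLength 𝔪 (𝔪 ^ 2) ≤ relLength D (𝔪 * Ideal.span {y}) := by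
  have hξ' : ∀ i, ξ.coeff i ∈ 𝔪 := fun i => hξ ▸ Ideal.subset_span ⟨i, rfl⟩
  set d := ξ.natDegree with hd
  obtain ⟨C', hC⟩ := exists_relLength_polyIn_le (N := fun k => 𝔪 ^ (k + 1)) hξ
    (fun k => pow_succ' _ _) hcolon
    (fun k => ne_top_of_le_ne_top (hfin (k + 1)) (relLength_mono_left le_top _)) hk (by
        simpa only [zero_add, pow_one, one_add_one_eq_two] using heq)
  simp only [zero_add, pow_one, one_add_one_eq_two, ← hd] at hC
  set Y : Ideal R := 𝔪 * Ideal.span {y} with hY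
  have hYle : Y ≤ 𝔪 ^ 2 := by
    rw [pow_two]
    exact Ideal.mul_mono_right ((Ideal.span_singleton_le_iff_mem _).mpr hym)
  refine ENat.le_of_forall_nat_mul_le
    (C := ((d + 1) * C' : ℕ) + d * relLength ⊤ Y)
    (WithTop.add_ne_top.mpr ⟨ENat.natCast_ne_top _, ENat.mul_ne_top_of_ne_top (ENat.natCast_ne_top _)
      hfiny⟩) fun p => ?_
  set U := polyIn p (⊤ : Ideal R) ⊓ (polyIn (p + d) Y).comap (LinearMap.mulLeft R ξ) with hU
  set W := polyIn p (⊤ : Ideal R) ⊓ (polyIn (p + d) (𝔪 * Y)).comap (LinearMap.mulLeft R ξ) with hW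
  -- For `g ∈ W`, the product `ξ g` has coefficients in `𝔪Y = y𝔪²`, which is within `C'` of `ξ y𝔪`.
  -- Where `ξ g` agrees with some `ξ y g₁` modulo `y𝔪^(k+2)`, cancelling `ξ` by the McCoy argument
  -- gives `g ∈ Y`.
  have upperW : relLength W (polyIn p Y) ≤ C' := by
    have hS : W ⊓ ((((polyIn p 𝔪).map (LinearMap.mulLeft R ξ) ⊔
        polyIn (p + d) (𝔪 ^ (k + 1 + 1))).map (LinearMap.mulLeft R (C y))).comap
          (LinearMap.mulLeft R ξ)) ≤ polyIn p Y := by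
      rintro g ⟨hgW, z, hz, hzg⟩
      obtain ⟨z₁, ⟨g₁, hg₁, rfl⟩, z₂, hz₂, rfl⟩ := Submodule.mem_sup.mp hz
      simp only [LinearMap.mulLeft_apply] at hzg
      have hg₁' : C y * g₁ ∈ polyIn p Y :=
        map_C_mul_polyIn_le (fun z hz => by
          rw [hY, mul_comm y]
          exact Ideal.mul_mem_mul hz (Ideal.mem_span_singleton_self y)) ⟨g₁, hg₁, rfl⟩
      have hmem : ∀ i, (g - C y * g₁).coeff i ∈ 𝔪 ^ (k + 1) * Ideal.span {y} := by
        refine polyIn_of_mul_mem (N := fun k => 𝔪 ^ k * Ideal.span {y}) hξ' hξ.ge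
          (fun k => by simp only [pow_succ', mul_assoc]; exact le_rfl) hcolon' p (k + 1) (by omega)
          _ (fun i hi => ?_) (fun i => ?_)
        · rw [coeff_sub, (hgW.1 i).2 hi, (hg₁' i).2 hi, sub_zero]
        · have e : ξ * (g - C y * g₁) = C y * z₂ := by
            rw [mul_sub, ← hzg]
            ring
          rw [e, coeff_C_mul, mul_comm y]
          exact Ideal.mul_mem_mul (hz₂ i).1 (Ideal.mem_span_singleton_self y)
      have hsub : g - C y * g₁ ∈ polyIn p Y := fun i => by
        refine ⟨Ideal.mul_mono_left (Ideal.pow_le_self (by omega)) (hmem i), fun hi => ?_⟩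
        rw [coeff_sub, (hgW.1 i).2 hi, (hg₁' i).2 hi, sub_zero]
      have := add_mem hsub hg₁'
      rwa [sub_add_cancel] at this
    refine (relLength_le_of_inf_le hS).trans ?_
    rw [← relLength_map]
    refine (relLength_mono_left (N₂ := (polyIn (p + d) (𝔪 ^ 2)).map
      (LinearMap.mulLeft R (C y))) ?_ _).trans ((relLength_map_map_le _ _ _).trans (hC p))
    refine (Submodule.map_le_iff_le_comap.mpr inf_le_right).trans ?_
    refine le_trans (polyIn_mono _ (le_of_eq ?_)) (polyIn_span_singleton_mul_le _ _ _)
    rw [hY, pow_two, ← mul_assoc, mul_comm]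
  have upper : relLength U (polyIn p Y) ≤ ((d + 1) * C' : ℕ) + p * relLength D Y := by
    refine (relLength_le_add U (polyIn p D) (polyIn_mono _ hD')).trans ?_
    rw [relLength_polyIn]
    refine add_le_add ?_ le_rfl
    -- The coefficients of `ξ` generate `𝔪`, so a polynomial that all of them send into `Y` has its
    -- coefficients in `D`.
    have hinf : U ⊓ (Finset.range (d + 1)).inf (fun i => (polyIn p Y).comap
        (LinearMap.mulLeft R (C (ξ.coeff i)))) ≤ polyIn p D := by
      rintro g ⟨hgU, hg⟩ j
      refine ⟨hD _ fun w hw => ?_, (hgU.1 j).2⟩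
      rw [← hξ] at hw
      refine Submodule.span_induction (p := fun w _ => w * g.coeff j ∈ Y) ?_ ?_ ?_ ?_ hw
      · rintro _ ⟨i, rfl⟩
        by_cases hi : i ∈ Finset.range (d + 1)
        · have h := (Finset.inf_le (f := fun i => (polyIn p Y).comap
            (LinearMap.mulLeft R (C (ξ.coeff i)))) hi hg j).1
          rwa [LinearMap.mulLeft_apply, coeff_C_mul] at h
        · rw [coeff_eq_zero_of_natDegree_lt (by simpa using hi), zero_mul]
          exact Y.zero_mem
      · simp
      · intro x y _ _ hx hy
        rw [add_mul]
        exact add_mem hx hy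
      · intro a x _ hx
        rw [smul_eq_mul, mul_assoc]
        exact Ideal.mul_mem_left _ _ hx
    refine (relLength_le_of_inf_le hinf).trans ((relLength_finset_inf_le _ _ _).trans ?_)
    refine (Finset.sum_le_card_nsmul _ _ (C' : ℕ∞) fun i _ => ?_).trans (by simp)
    rw [← relLength_map]
    -- A coefficient `c` of `ξ` maps `U` into `W`, because `ξ (c g) = c (ξ g)` has coefficients in
    -- `𝔪Y`.
    refine (relLength_mono_left ?_ _).trans upperW
    refine le_inf ?_ ?_
    · exact (Submodule.map_mono inf_le_left).trans (map_C_mul_polyIn_le fun _ _ => trivial)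
    · rw [← Submodule.map_le_iff_le_comap, map_mulLeft_comm]
      refine (Submodule.map_mono (Submodule.map_le_iff_le_comap.mpr inf_le_right)).trans ?_
      exact map_C_mul_polyIn_le fun z hz => Ideal.mul_mem_mul (hξ' i) hz
  refine (mul_relLength_le_relLength_comap hξ hfin hYle hfiny p).trans
    ((add_le_add upper le_rfl).trans_eq ?_)
  ring

end NearReduction

end

noncomputable section

/-! ### Multiplicity and minimal multiplicity over an arbitrary residue field. -/

section Multiplicity

variable {R : Type*} [CommRing R]

theorem ENat.toNat_add_toNat {a b c : ℕ∞} (h : a = b + c) (ha : a ≠ ⊤) :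
    a.toNat = b.toNat + c.toNat := by
  subst h
  have h := WithTop.add_ne_top.mp ha
  exact ENat.toNat_add h.1 h.2

variable [IsLocalRing R] [IsNoetherianRing R]

theorem relLength_top_maximalIdeal_pow_ne_top (k : ℕ) :
    relLength ⊤ (maximalIdeal R ^ k) ≠ ⊤ := by
  rw [relLength_top]
  rcases Nat.eq_zero_or_pos k with rfl | hk
  · have : Subsingleton (R ⧸ maximalIdeal R ^ 0) :=
      Ideal.Quotient.subsingleton_iff.mpr (by simp)
    rw [Module.length_eq_zero]
    simp
  · have hne : maximalIdeal R ^ k ≠ ⊤ :=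
      ne_top_of_le_ne_top (maximalIdeal.isMaximal R).ne_top (Ideal.pow_le_self hk.ne')
    have : Nontrivial (R ⧸ maximalIdeal R ^ k) := Ideal.Quotient.nontrivial_iff.mpr hne
    have hsurj : Function.Surjective (Ideal.Quotient.mk (maximalIdeal R ^ k)) :=
      Ideal.Quotient.mk_surjective
    have : IsLocalRing (R ⧸ maximalIdeal R ^ k) := IsLocalRing.of_surjective' _ hsurj
    have : IsArtinianRing (R ⧸ maximalIdeal R ^ k) := by
      rw [isArtinianRing_iff_isNilpotent_maximalIdeal]
      refine ⟨k, ?_⟩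
      have : IsLocalHom (Ideal.Quotient.mk (maximalIdeal R ^ k)) :=
        hsurj.isLocalHom
      rw [← IsLocalRing.map_maximalIdeal_of_surjective _ hsurj, ← Ideal.map_pow,
        Ideal.map_quotient_self, Ideal.zero_eq_bot]
    rw [Module.length_eq_of_surjective (R := R ⧸ maximalIdeal R ^ k) hsurj]
    exact Module.length_ne_top

theorem relLength_top_ne_top_of_pow_le {L : Ideal R} {s : ℕ} (h : maximalIdeal R ^ s ≤ L) :
    relLength ⊤ L ≠ ⊤ :=
  ne_top_of_le_ne_top (relLength_top_maximalIdeal_pow_ne_top s) (relLength_anti_right _ h)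

/-- The Hilbert function is bounded by the colength of a parameter. -/
theorem relLength_pow_succ_le {y : R} (hy : y ∈ nonZeroDivisors R) (hym : y ∈ maximalIdeal R)
    (k : ℕ) : relLength (maximalIdeal R ^ k) (maximalIdeal R ^ (k + 1))
      ≤ relLength ⊤ (Ideal.span {y}) := by
  set 𝔪 := maximalIdeal R
  have hle : Ideal.span {y} * 𝔪 ^ k ≤ 𝔪 ^ (k + 1) := by
    rw [pow_succ']
    exact Ideal.mul_mono_left ((Ideal.span_singleton_le_iff_mem _).mpr hym)
  refine (relLength_anti_right _ hle).trans ?_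
  have e1 := relLength_add (N := (⊤ : Ideal R)) (hle.trans (Ideal.pow_le_pow_right k.le_succ))
    le_top
  have e2 := relLength_add (N := (⊤ : Ideal R)) (N'' := Ideal.span {y} * 𝔪 ^ k)
    (Ideal.mul_le_left : _ ≤ Ideal.span {y}) le_top
  have e3 : relLength (Ideal.span {y}) (Ideal.span {y} * 𝔪 ^ k) = relLength ⊤ (𝔪 ^ k) := by
    rw [← map_mulLeft_eq_span_mul, ← relLength_map_map
      (mulLeft_injective_of_mem_nonZeroDivisors hy) (⊤ : Ideal R), map_mulLeft_eq_span_mul y ⊤,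
      Ideal.mul_top]
  rw [e1, e3, add_comm] at e2
  exact (ENat.add_left_injective_of_ne_top (relLength_top_maximalIdeal_pow_ne_top k) e2).le

/-- The Hilbert function of a one-dimensional Cohen–Macaulay local ring is eventually constant,
and bounded by its eventual value. -/
theorem exists_hilbertFunction_eventually_const {y : R} (hy : y ∈ nonZeroDivisors R)
    (hym : y ∈ maximalIdeal R) {s : ℕ} (hs : maximalIdeal R ^ s ≤ Ideal.span {y}) :
    ∃ e k₁ : ℕ, (∀ k ≥ k₁, relLength (maximalIdeal R ^ k) (maximalIdeal R ^ (k + 1)) = e) ∧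
      ∀ j, relLength (maximalIdeal R ^ j) (maximalIdeal R ^ (j + 1)) ≤ e := by
  set 𝔪 := maximalIdeal R
  obtain ⟨ξ, hξ⟩ := exists_polynomial_span_coeff_eq (IsNoetherian.noetherian 𝔪)
  obtain ⟨k₀, hk₀⟩ := exists_colon_pow_mul_le hy hym ⊤
  simp only [Ideal.mul_top] at hk₀
  have hmono : ∀ j k, k₀ ≤ k → j ≤ k →
      relLength (𝔪 ^ j) (𝔪 ^ (j + 1)) ≤ relLength (𝔪 ^ k) (𝔪 ^ (k + 1)) := by
    intro j k hk hjk
    have h := relLength_zero_one_le (N := fun i => 𝔪 ^ (j + i)) hξ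
      (fun i => by rw [← add_assoc, pow_succ']) (k₀ := k₀ - j)
      (fun i hi z hz => hk₀ (j + i) (by omega) z hz)
      (fun i => ne_top_of_le_ne_top (relLength_top_maximalIdeal_pow_ne_top (j + i))
        (relLength_mono_left le_top _)) (k := k - j) (by omega)
    simpa only [add_zero, ← add_assoc, Nat.add_sub_cancel' hjk] using h
  have hfin : ∀ k, ∃ n : ℕ, relLength (𝔪 ^ k) (𝔪 ^ (k + 1)) = n := fun k => by
    obtain ⟨n, hn⟩ := ENat.ne_top_iff_exists.mp (ne_top_of_le_ne_top
      (relLength_top_ne_top_of_pow_le hs) (relLength_pow_succ_le hy hym k))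
    exact ⟨n, hn.symm⟩
  choose h hh using hfin
  obtain ⟨B, hB⟩ := ENat.ne_top_iff_exists.mp (relLength_top_ne_top_of_pow_le hs)
  have hbdd : ∀ k, h k ≤ B := fun k => by
    have := relLength_pow_succ_le hy hym k
    rw [← hB, hh] at this
    exact_mod_cast this
  simp only [hh, Nat.cast_le, Nat.cast_inj] at hmono ⊢
  -- Beyond `k₀` the Hilbert function is monotone and bounded, so it is constant from the point
  -- where it attains its maximum.
  obtain ⟨e, ⟨k₁, hk₁, rfl⟩, hmax⟩ : ∃ e, e ∈ h '' Set.Ici k₀ ∧ ∀ e' ∈ h '' Set.Ici k₀, e' ≤ e := by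
    have hfinite : (h '' Set.Ici k₀).Finite :=
      (Set.finite_Iic B).subset (by rintro _ ⟨k, _, rfl⟩; exact hbdd k)
    exact hfinite.exists_maximalFor id _ ⟨_, k₀, Set.self_mem_Ici, rfl⟩ |>.imp fun e he =>
      ⟨he.1, fun e' he' => by
        by_contra! hlt
        exact absurd (he.2 he' hlt.le) (not_le.mpr hlt)⟩
  rw [Set.mem_Ici] at hk₁
  refine ⟨h k₁, k₁, fun k hk => le_antisymm (hmax _ ⟨k, hk₁.trans hk, rfl⟩)
    (hmono k₁ k (hk₁.trans hk) hk), fun j => ?_⟩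
  exact (hmono j (max j k₁) (hk₁.trans (le_max_right _ _)) (le_max_left _ _)).trans
    (hmax _ ⟨_, hk₁.trans (le_max_right _ _), rfl⟩)

theorem tendsto_hilbertSamuelRatio {e k₁ : ℕ}
    (h : ∀ k ≥ k₁, relLength (maximalIdeal R ^ k) (maximalIdeal R ^ (k + 1)) = e) :
    Tendsto (hilbertSamuelRatio R) atTop (𝓝 e) := by
  set F : ℕ → ℕ := fun k => (Module.length R (R ⧸ maximalIdeal R ^ k)).toNat with hF
  have hsucc : ∀ k ≥ k₁, F (k + 1) = F k + e := by
    intro k hk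
    have h1 := relLength_add (N := (⊤ : Ideal R)) (Ideal.pow_le_pow_right k.le_succ) le_top
      (N' := maximalIdeal R ^ k)
    have h2 := ENat.toNat_add_toNat h1 (relLength_top_maximalIdeal_pow_ne_top _)
    rw [Nat.succ_eq_add_one, h k hk, relLength_top, relLength_top, ENat.toNat_natCast] at h2
    exact h2
  have hlin : ∀ j, F (k₁ + j) = F k₁ + j * e := by
    intro j
    induction j with
    | zero => simp
    | succ j ih =>
      rw [← add_assoc, hsucc _ (by omega), ih]
      ring
  have hlim : Tendsto (fun n : ℕ => ((F k₁ : ℝ) - k₁ * e) / n + e) atTop (𝓝 (0 + e)) :=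
    (tendsto_const_div_atTop_nhds_zero_nat _).add tendsto_const_nhds
  rw [zero_add] at hlim
  refine hlim.congr' ?_
  filter_upwards [eventually_ge_atTop k₁, eventually_gt_atTop 0] with n hn hn0
  have h1 := hlin (n - k₁)
  rw [Nat.add_sub_cancel' hn] at h1
  change _ = (F n : ℝ) / n
  have hn' : (n : ℝ) ≠ 0 := by positivity
  rw [h1]
  push_cast [Nat.cast_sub hn]
  field_simp
  ring

theorem embeddingDim_eq_relLength :
    (embeddingDim R : ℕ∞) = relLength (maximalIdeal R) (maximalIdeal R ^ 2) := by
  rw [embeddingDim, spanFinrank_maximalIdeal_eq_finrank_cotangentSpace,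
    ← Module.length_eq_finrank, ← Module.length_eq_of_surjective (S := R)
      (IsLocalRing.residue_surjective)]
  have hrange : LinearMap.range (maximalIdeal R).cotangentToQuotientSquare =
      Submodule.map (Submodule.mkQ (maximalIdeal R ^ 2)) (maximalIdeal R) := by
    ext z
    constructor
    · rintro ⟨x, rfl⟩
      obtain ⟨x, rfl⟩ := (maximalIdeal R).toCotangent_surjective x
      exact ⟨x, x.2, rfl⟩
    · rintro ⟨x, hx, rfl⟩
      exact ⟨(maximalIdeal R).toCotangent ⟨x, hx⟩, rfl⟩
  rw [relLength, ← hrange]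
  exact (LinearEquiv.ofInjective _
    (maximalIdeal R).cotangentToQuotientSquare_injective).length_eq

/-- A one-dimensional Cohen–Macaulay local ring has minimal multiplicity if and only if its type is
one less than its multiplicity; here `D / y𝔪` has length `r + 1`. -/
theorem embeddingDim_eq_iff_relLength_colon_eq {y : R} (hy : y ∈ nonZeroDivisors R)
    (hym : y ∈ maximalIdeal R) {s : ℕ} (hs : maximalIdeal R ^ s ≤ Ideal.span {y}) {e k₁ : ℕ}
    (he : ∀ k ≥ k₁, relLength (maximalIdeal R ^ k) (maximalIdeal R ^ (k + 1)) = e)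
    (hle : ∀ j, relLength (maximalIdeal R ^ j) (maximalIdeal R ^ (j + 1)) ≤ e) {D : Ideal R}
    (hD : ∀ z, z ∈ D ↔ ∀ w ∈ maximalIdeal R, w * z ∈ maximalIdeal R * Ideal.span {y})
    (hyD : y ∈ D) :
    embeddingDim R = e ↔ relLength D (maximalIdeal R * Ideal.span {y}) = e := by
  rw [← Nat.cast_inj (R := ℕ∞), embeddingDim_eq_relLength]
  set 𝔪 := maximalIdeal R
  obtain ⟨ξ, hξ⟩ := exists_polynomial_span_coeff_eq (IsNoetherian.noetherian 𝔪)
  have hmD : 𝔪 * D = 𝔪 * Ideal.span {y} :=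
    le_antisymm (Ideal.mul_le.mpr fun w hw z hz => (hD z).mp hz w hw)
      (Ideal.mul_mono_right ((Ideal.span_singleton_le_iff_mem _).mpr hyD))
  have hpowD : ∀ k, 𝔪 ^ (k + 1) * D = Ideal.span {y} * 𝔪 ^ (k + 1) := fun k => by
    rw [pow_succ, mul_assoc, hmD, ← mul_assoc, mul_comm]
  -- Because `𝔪D = y𝔪`, multiplication by `y` carries `𝔪^(k+1)` onto `𝔪^(k+1) D`; only index zero
  -- tells the two Hilbert functions apart.
  have hshift : ∀ k, relLength (𝔪 ^ (k + 1) * D) (𝔪 ^ (k + 1 + 1) * D) =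
      relLength (𝔪 ^ (k + 1)) (𝔪 ^ (k + 1 + 1)) := fun k => by
    rw [hpowD, hpowD, ← map_mulLeft_eq_span_mul, ← map_mulLeft_eq_span_mul,
      relLength_map_map (mulLeft_injective_of_mem_nonZeroDivisors hy)]
  have hfiny : relLength ⊤ (𝔪 * Ideal.span {y}) ≠ ⊤ :=
    relLength_top_ne_top_of_pow_le (s := s + 1) (by
      rw [pow_succ']
      exact Ideal.mul_mono_right hs)
  obtain ⟨k₀, hk₀⟩ := exists_colon_pow_mul_le hy hym D
  obtain ⟨k₂, hk₂⟩ := exists_colon_pow_mul_le hy hym ⊤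
  obtain ⟨k₃, hk₃⟩ := exists_colon_pow_mul_le hy hym (Ideal.span {y})
  simp only [Ideal.mul_top] at hk₂
  set k := max (max k₀ k₁) (max k₂ k₃) with hk
  have hND : ∀ i, 𝔪 ^ (i + 1) * D = 𝔪 * (𝔪 ^ i * D) := fun i => by rw [pow_succ', mul_assoc]
  have hfinD : ∀ i, relLength (𝔪 ^ 0 * D) (𝔪 ^ i * D) ≠ ⊤ := fun i =>
    ne_top_of_le_ne_top (relLength_top_ne_top_of_pow_le (L := 𝔪 ^ i * D) (s := i + s) (by
      rw [pow_add]
      exact Ideal.mul_mono_right (hs.trans ((Ideal.span_singleton_le_iff_mem _).mpr hyD))))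
      (relLength_mono_left le_top _)
  have hDle : relLength D (𝔪 * Ideal.span {y}) ≤ e := by
    have h := relLength_zero_one_le (N := fun i => 𝔪 ^ i * D) hξ hND hk₀ hfinD
      (k := k + 1) (by omega)
    rw [hshift, he (k + 1) (by omega)] at h
    simpa only [pow_zero, one_mul, zero_add, pow_one, hmD, Ideal.one_eq_top, Ideal.top_mul] using h
  constructor
  · intro h
    refine le_antisymm hDle ?_
    rw [← h]
    refine relLength_le_relLength_colon hξ hym (k₀ := max k₂ k₃)
      (fun k hk z hz => hk₂ (k + 1) (by omega) z hz)
      (fun k hk z hz => hk₃ k (by omega) z hz)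
      relLength_top_maximalIdeal_pow_ne_top hfiny (k := k) (by omega) ?_
      (fun z hz => (hD z).mpr hz) (hmD ▸ Ideal.mul_le_right)
    rw [h, he (k + 1) (by omega)]
  · intro h
    refine le_antisymm (by simpa using hle 1) ?_
    -- Equality at index zero for `D` propagates to index one, where the Hilbert function of `D` is
    -- the embedding dimension of `R`.
    have h2 := relLength_succ_le_relLength_one (N := fun i => 𝔪 ^ i * D) hξ hND hk₀ hfinD
      (k := k + 1) (by omega) (by
        rw [hshift, he (k + 1) (by omega)]
        simpa only [pow_zero, one_mul, zero_add, pow_one, hmD, Ideal.one_eq_top, Ideal.top_mul]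
          using h)
    have h3 := hshift 0
    have h4 := hshift (k + 1)
    rw [he (k + 1 + 1) (by omega)] at h4
    simp only [zero_add, pow_one, one_add_one_eq_two] at h2 h3
    rw [← h3, ← h4]
    exact h2

end Multiplicity

end

noncomputable section

/-! ### The type as the length of a socle. -/

section CohenMacaulayType

open CategoryTheory Abelian

universe u

variable {R : Type u} [CommRing R]

/-- The short complex `R → R → R / yR` of multiplication by `y`. -/
abbrev mulShortComplex (y : R) : ShortComplex (ModuleCat.{u} R) :=
  ShortComplex.mk (ModuleCat.ofHom (LinearMap.lsmul R R y))
    (ModuleCat.ofHom (Submodule.mkQ (Ideal.span {y}))) (by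
      ext
      simp)

theorem mulShortComplex_shortExact {y : R} (hy : y ∈ nonZeroDivisors R) :
    (mulShortComplex y).ShortExact where
  exact := by
    rw [ShortComplex.moduleCat_exact_iff]
    intro z hz
    have hz' : (z : R) ∈ Ideal.span {y} := (Submodule.Quotient.mk_eq_zero _).mp hz
    obtain ⟨w, hw⟩ : ∃ w : R, (z : R) = y * w := Ideal.mem_span_singleton.mp hz'
    exact ⟨w, hw.symm⟩
  mono_f := (ModuleCat.mono_iff_injective (mulShortComplex y).f).mpr
    (mulLeft_injective_of_mem_nonZeroDivisors hy)
  epi_g := (ModuleCat.epi_iff_surjective _).mpr (Submodule.mkQ_surjective _)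

variable [IsLocalRing R]

/-- The connecting map of `0 → R → R → R/(y) → 0` is bijective: `y` kills the residue field `k`, so
it acts as zero on `Ext¹(k, R)`, and it is regular on `R`, so `Hom(k, R) = 0`. -/
theorem cmType_eq_length_hom {y : R} (hy : y ∈ nonZeroDivisors R) (hym : y ∈ maximalIdeal R) :
    cmType R = Module.length R (ResidueField R →ₗ[R] R ⧸ Ideal.span {y}) := by
  have hS := mulShortComplex_shortExact hy
  let X := ModuleCat.of R (ResidueField R)
  have hyk : y • 𝟙 X = 0 := by
    ext z
    obtain ⟨z, rfl⟩ := IsLocalRing.residue_surjective z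
    change residue R y * residue R z = 0
    rw [(residue_eq_zero_iff y).mpr hym, zero_mul]
  let φ : Ext X (mulShortComplex y).X₃ 0 →ₗ[R] Ext X (mulShortComplex y).X₁ 1 :=
    hS.extClass.postcompOfLinear R X (zero_add 1)
  have hinj : Function.Injective φ := by
    rw [injective_iff_map_eq_zero]
    intro x₃ hx₃
    obtain ⟨x₂, rfl⟩ := Ext.covariant_sequence_exact₃ X hS x₃ (zero_add 1) hx₃
    obtain ⟨f, rfl⟩ := (Ext.linearEquiv₀ (R := R)).symm.surjective x₂
    have : f = 0 := by
      have hyf : y • f = 0 := by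
        rw [← Category.id_comp f, ← Linear.smul_comp, hyk, Limits.zero_comp]
      ext z
      have h1 : y * (f.hom z : R) = 0 := congrArg (fun g => ModuleCat.Hom.hom g z) hyf
      exact (mul_left_mem_nonZeroDivisors_eq_zero_iff hy).mp h1
    rw [this]
    simp
  have hsurj : Function.Surjective φ := by
    intro x₁
    refine Ext.covariant_sequence_exact₁ X hS x₁ ?_ (zero_add 1)
    have : (mulShortComplex y).f = y • 𝟙 (mulShortComplex y).X₁ := by
      ext
      rfl
    have h1 : x₁.comp (Ext.mk₀ (mulShortComplex y).f) (add_zero 1) = y • x₁ := by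
      rw [this, Ext.mk₀_smul]
      simp
    have h2 : y • x₁ = (Ext.mk₀ (y • 𝟙 X)).comp x₁ (zero_add 1) := by
      simp [Ext.mk₀_smul]
    rw [h1, h2, hyk, Ext.mk₀_zero, Ext.zero_comp]
  exact (((Ext.linearEquiv₀ (R := R)).symm.trans (LinearEquiv.ofBijective φ ⟨hinj, hsurj⟩)).symm.trans
    ModuleCat.homLinearEquiv).length_eq

/-- Evaluation at `1` identifies homomorphisms from the residue field to `R/(y)` with the socle of
`R/(y)`. -/
theorem cmType_eq_relLength {y : R} (hy : y ∈ nonZeroDivisors R) (hym : y ∈ maximalIdeal R)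
    {D : Ideal R} (hD : ∀ z, z ∈ D ↔ ∀ w ∈ maximalIdeal R, w * z ∈ Ideal.span {y}) :
    cmType R = relLength D (Ideal.span {y}) := by
  rw [cmType_eq_length_hom hy hym]
  let ev : (ResidueField R →ₗ[R] R ⧸ Ideal.span {y}) →ₗ[R] R ⧸ Ideal.span {y} :=
    LinearMap.applyₗ (1 : ResidueField R)
  have hinj : Function.Injective ev := by
    intro f g hfg
    refine LinearMap.ext fun z => ?_
    obtain ⟨z, rfl⟩ := IsLocalRing.residue_surjective z
    have e : residue R z = z • (1 : ResidueField R) := by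
      rw [Algebra.smul_def, mul_one]
      rfl
    rw [e, map_smul, map_smul]
    exact congrArg (z • ·) hfg
  have hrange : LinearMap.range ev = Submodule.map (Submodule.mkQ (Ideal.span {y})) D := by
    ext z
    constructor
    · rintro ⟨f, rfl⟩
      obtain ⟨z, hz⟩ := Submodule.mkQ_surjective _ (ev f)
      refine ⟨z, (hD z).mpr fun w hw => ?_, hz⟩
      have h1 : w • (1 : ResidueField R) = 0 := by
        rw [Algebra.smul_def, mul_one]
        exact (residue_eq_zero_iff w).mpr hw
      have h2 : w • Submodule.mkQ (Ideal.span {y}) z = 0 := by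
        rw [hz]
        change w • f 1 = 0
        rw [← map_smul, h1, map_zero]
      rw [← map_smul] at h2
      exact (Submodule.Quotient.mk_eq_zero _).mp h2
    · rintro ⟨z, hz, rfl⟩
      refine ⟨Submodule.liftQ (maximalIdeal R) (LinearMap.toSpanSingleton R _ (Submodule.mkQ (Ideal.span {y}) z)) ?_, ?_⟩
      · intro w hw
        rw [LinearMap.mem_ker, LinearMap.toSpanSingleton_apply, ← map_smul]
        exact (Submodule.Quotient.mk_eq_zero _).mpr ((hD z).mp hz w hw)
      · exact one_smul R (Submodule.mkQ (Ideal.span {y}) z)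
  rw [relLength, ← hrange]
  exact (LinearEquiv.ofInjective ev hinj).length_eq

end CohenMacaulayType

end

noncomputable section

/-! ### Parameters in one-dimensional Cohen–Macaulay rings. -/

section CohenMacaulay

variable {R : Type*} [CommRing R]

theorem IsCohenMacaulayLocalRing.exists_mem_nonZeroDivisors [IsCohenMacaulayLocalRing R]
    (hdim : ringKrullDim R = 1) : ∃ y ∈ nonZeroDivisors R, y ∈ maximalIdeal R := by
  obtain ⟨rs, hrs, hlen⟩ := IsCohenMacaulayLocalRing.exists_regular_sequence (R := R)
  rw [hdim] at hlen
  have hlen1 : rs.length = 1 := by exact_mod_cast hlen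
  obtain ⟨y, rfl⟩ := List.length_eq_one_iff.mp hlen1
  refine ⟨y, ?_, ?_⟩
  · have h := ((RingTheory.Sequence.isRegular_cons_iff R y []).mp hrs).1
    refine mem_nonZeroDivisors_iff_right.mpr fun z hz => h ?_
    simpa [mul_comm] using hz
  · by_contra hy
    have hu : IsUnit y := by
      rwa [mem_maximalIdeal, mem_nonunits_iff, not_not] at hy
    refine hrs.top_ne_smul ?_
    rw [Ideal.ofList_singleton, Ideal.span_singleton_eq_top.mpr hu, Submodule.top_smul]

theorem isCohenMacaulayLocalRing_and_ringKrullDim_eq_one [IsLocalRing R] [IsNoetherianRing R]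
    {y : R} (hy : y ∈ nonZeroDivisors R) (hym : y ∈ maximalIdeal R) {s : ℕ}
    (hs : maximalIdeal R ^ s ≤ Ideal.span {y}) :
    IsCohenMacaulayLocalRing R ∧ ringKrullDim R = 1 := by
  have hreg : IsSMulRegular R y := 
    Module.Flat.isSMulRegular_of_nonZeroDivisors hy
  have hne : Ideal.span {y} ≠ ⊤ := by
    rw [Ne, Ideal.span_singleton_eq_top]
    exact hym
  have hdim : ringKrullDim R = 1 := by
    rw [← ringKrullDim_quotient_span_singleton_succ_eq_ringKrullDim_of_mem_jacobson hreg
      (by rw [IsLocalRing.ringJacobson_eq_maximalIdeal]; exact hym)]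
    have : Nontrivial (R ⧸ Ideal.span {y}) := Ideal.Quotient.nontrivial_iff.mpr hne
    have hsurj : Function.Surjective (Ideal.Quotient.mk (Ideal.span {y})) :=
      Ideal.Quotient.mk_surjective
    have : IsLocalRing (R ⧸ Ideal.span {y}) := IsLocalRing.of_surjective' _ hsurj
    have : IsArtinianRing (R ⧸ Ideal.span {y}) := by
      rw [isArtinianRing_iff_isNilpotent_maximalIdeal]
      refine ⟨s, ?_⟩
      have : IsLocalHom (Ideal.Quotient.mk (Ideal.span {y})) := hsurj.isLocalHom
      rw [← IsLocalRing.map_maximalIdeal_of_surjective _ hsurj, ← Ideal.map_pow,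
        Ideal.zero_eq_bot, eq_bot_iff, ← Ideal.map_quotient_self (Ideal.span {y})]
      exact Ideal.map_mono hs
    rw [ringKrullDimZero_iff_ringKrullDim_eq_zero.mp
      (isArtinianRing_iff_krullDimLE_zero.mp this), zero_add]
  refine ⟨⟨[y], ?_, by rw [hdim]; rfl⟩, hdim⟩
  refine ⟨(RingTheory.Sequence.isWeaklyRegular_cons_iff R y []).mpr
    ⟨hreg, RingTheory.Sequence.IsWeaklyRegular.nil R _⟩, ?_⟩
  rw [Ideal.ofList_singleton, smul_eq_mul, Ideal.mul_top]
  exact hne.symm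

variable [IsLocalRing R] [IsNoetherianRing R]

theorem exists_maximalIdeal_pow_le {L : Ideal R} (h : L.radical = maximalIdeal R) :
    ∃ s, maximalIdeal R ^ s ≤ L := by
  obtain ⟨s, hs⟩ := Ideal.exists_radical_pow_le_of_fg L (IsNoetherian.noetherian _)
  exact ⟨s, h ▸ hs⟩

/-- A generator of a reduction with reduction number one of an `𝔪`-primary ideal is a
nonzerodivisor generating an `𝔪`-primary ideal. -/
theorem mem_nonZeroDivisors_of_sq_eq {J : Ideal R} (hJ : J.radical = maximalIdeal R) {b : R}
    (hb : J ^ 2 = Ideal.span {b} * J) {y : R} (hy : y ∈ nonZeroDivisors R)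
    (hym : y ∈ maximalIdeal R) :
    b ∈ nonZeroDivisors R ∧ ∃ s, maximalIdeal R ^ s ≤ Ideal.span {b} := by
  obtain ⟨s, hs⟩ := exists_maximalIdeal_pow_le hJ
  have hle : maximalIdeal R ^ (s * 2) ≤ Ideal.span {b} := by
    rw [pow_mul]
    refine (Ideal.pow_right_mono hs 2).trans ?_
    rw [hb]
    exact Ideal.mul_le_inf.trans inf_le_left
  refine ⟨?_, s * 2, hle⟩
  obtain ⟨c, hc⟩ := Ideal.mem_span_singleton'.mp (hle (Ideal.pow_mem_pow hym _))
  have h : c * b ∈ nonZeroDivisors R := hc ▸ pow_mem hy _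
  exact (mul_mem_nonZeroDivisors.mp h).2

end CohenMacaulay

/-! ### Bases of the conormal module of an Ulrich ideal. -/

section CotangentBasis

variable {R : Type*} [CommRing R]

/-- A family of generators of the ideal `I` which is a basis of `I / I²` over `R / I`. -/
structure IsCotangentBasis {ι : Type*} [Fintype ι] (I : Ideal R) (x : ι → R) : Prop where
  span_eq : Ideal.span (Set.range x) = I
  mem_of_sum_mem : ∀ r : ι → R, ∑ i, r i * x i ∈ I ^ 2 → ∀ i, r i ∈ I

variable {ι : Type*} [Fintype ι] {I : Ideal R} {x : ι → R}

theorem IsCotangentBasis.mem (h : IsCotangentBasis I x) (i : ι) : x i ∈ I :=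
  h.span_eq ▸ Ideal.subset_span ⟨i, rfl⟩

theorem IsCotangentBasis.exists_sum (h : IsCotangentBasis I x) {z : R} (hz : z ∈ I) :
    ∃ r : ι → R, z = ∑ i, r i * x i := by
  rw [← h.span_eq] at hz
  obtain ⟨r, hr⟩ := (Ideal.mem_span_range_iff_exists_fun).mp hz
  exact ⟨r, hr.symm⟩

theorem IsCotangentBasis.exists_sum_of_mem_mul (h : IsCotangentBasis I x) {c : Ideal R} {z : R}
    (hz : z ∈ c * I) : ∃ r : ι → R, (∀ i, r i ∈ c) ∧ z = ∑ i, r i * x i := by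
  refine Submodule.mul_induction_on hz (fun s hs t ht => ?_) (fun u v hu hv => ?_)
  · obtain ⟨r, rfl⟩ := h.exists_sum ht
    exact ⟨fun i => s * r i, fun i => c.mul_mem_right _ hs, by
      rw [Finset.mul_sum]; exact Finset.sum_congr rfl fun i _ => by ring⟩
  · obtain ⟨r, hr, rfl⟩ := hu
    obtain ⟨r', hr', rfl⟩ := hv
    exact ⟨fun i => r i + r' i, fun i => add_mem (hr i) (hr' i), by
      simp only [add_mul, Finset.sum_add_distrib]⟩

theorem toCotangent_sum (hx : ∀ i, x i ∈ I) (r : ι → R) :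
    I.toCotangent ⟨∑ i, r i * x i, Ideal.sum_mem _ fun i _ => I.mul_mem_left _ (hx i)⟩ =
      ∑ i, Ideal.Quotient.mk I (r i) • I.toCotangent ⟨x i, hx i⟩ := by
  have e : (⟨∑ i, r i * x i, Ideal.sum_mem _ fun i _ => I.mul_mem_left _ (hx i)⟩ : I) =
      ∑ i, r i • ⟨x i, hx i⟩ := by
    apply Subtype.ext
    simp
  rw [e, map_sum]
  exact Finset.sum_congr rfl fun i _ => map_smul _ _ _

/-- The basis of the conormal module defined by a family of generators. -/
def IsCotangentBasis.basis (h : IsCotangentBasis I x) : Module.Basis ι (R ⧸ I) I.Cotangent :=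
  Module.Basis.mk (v := fun i => I.toCotangent ⟨x i, h.mem i⟩)
    (by
      rw [Fintype.linearIndependent_iff]
      intro g hg i
      choose r hr using fun i => Ideal.Quotient.mk_surjective (I := I) (g i)
      rw [← hr i, Ideal.Quotient.eq_zero_iff_mem]
      refine h.mem_of_sum_mem r ?_ i
      have := toCotangent_sum h.mem r
      simp only [hr, hg] at this
      exact (I.toCotangent_eq_zero _).mp this)
    (by
      rintro z -
      obtain ⟨⟨z, hz⟩, rfl⟩ := I.toCotangent_surjective z
      obtain ⟨r, rfl⟩ := h.exists_sum hz
      rw [toCotangent_sum h.mem]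
      exact Submodule.sum_mem _ fun i _ => Submodule.smul_mem _ _ (Submodule.subset_span ⟨i, rfl⟩))

theorem IsCotangentBasis.spanFinrank_eq (h : IsCotangentBasis I x) (hI : I ≠ ⊤) :
    I.spanFinrank = Fintype.card ι := by
  have : Nontrivial (R ⧸ I) := Ideal.Quotient.nontrivial_iff.mpr hI
  apply le_antisymm
  · rw [← h.span_eq]
    refine (Submodule.spanFinrank_span_le_ncard_of_finite (Set.finite_range x)).trans ?_
    rw [← Set.image_univ]
    exact (Set.ncard_image_le Set.finite_univ).trans (by simp [Set.ncard_univ])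
  · have hfg : I.FG := by
      rw [← h.span_eq]
      exact Submodule.fg_span (Set.finite_range x)
    obtain ⟨s, hs, hspan⟩ := Submodule.FG.exists_span_finset_card_eq_spanFinrank hfg
    rw [← Module.finrank_eq_card_basis h.basis, ← hs, ← Fintype.card_coe]
    have hmem : ∀ i : s, (i : R) ∈ I := fun i => hspan ▸ Submodule.subset_span i.2
    refine finrank_le_of_span_eq_top (v := fun i : s => I.toCotangent ⟨i, hmem i⟩) ?_
    rw [eq_top_iff]
    rintro z -
    obtain ⟨⟨z, hz⟩, rfl⟩ := I.toCotangent_surjective z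
    have hz' : z ∈ Ideal.span (Set.range ((↑) : s → R)) := by
      rw [Subtype.range_coe]
      have h1 : Ideal.span (s : Set R) = I := hspan
      rw [h1]
      exact hz
    obtain ⟨r, rfl⟩ := Ideal.mem_span_range_iff_exists_fun.mp hz'
    rw [toCotangent_sum hmem]
    exact Submodule.sum_mem _ fun i _ => Submodule.smul_mem _ _ (Submodule.subset_span ⟨i, rfl⟩)

variable [IsLocalRing R]

/-- Exchange: an element outside `𝔪I` has a unit among its coordinates and can replace that basis
vector. -/
theorem IsCotangentBasis.exists_update [DecidableEq ι] (h : IsCotangentBasis I x) {a : R}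
    (haI : a ∈ I) (ha : a ∉ maximalIdeal R * I) :
    ∃ i₀, IsCotangentBasis I (Function.update x i₀ a) := by
  obtain ⟨c, hc⟩ := h.exists_sum haI
  obtain ⟨i₀, hi₀⟩ : ∃ i₀, IsUnit (c i₀) := by
    by_contra! hcon
    refine ha ?_
    rw [hc]
    exact Ideal.sum_mem _ fun i _ => Ideal.mul_mem_mul (hcon i) (h.mem i)
  have hmem : ∀ i, Function.update x i₀ a i ∈ I := fun i => by
    rcases eq_or_ne i i₀ with rfl | hi
    · rwa [Function.update_self]
    · rw [Function.update_of_ne hi]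
      exact h.mem i
  have ha' : c i₀ * x i₀ = a - ∑ i ∈ Finset.univ.erase i₀, c i * x i := by
    rw [hc, ← Finset.add_sum_erase _ _ (Finset.mem_univ i₀)]
    ring
  have hsum : ∀ r : ι → R, ∑ i, r i * Function.update x i₀ a i =
      ∑ i, (Function.update r i₀ 0 i + r i₀ * c i) * x i := by
    intro r
    simp only [add_mul, Finset.sum_add_distrib, mul_assoc]
    rw [← Finset.mul_sum, ← hc, ← Finset.add_sum_erase _ _ (Finset.mem_univ i₀),
      ← Finset.add_sum_erase _ (fun i => Function.update r i₀ 0 i * x i) (Finset.mem_univ i₀)]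
    simp only [Function.update_self, zero_mul, zero_add]
    rw [add_comm]
    congr 1
    refine Finset.sum_congr rfl fun i hi => ?_
    rw [Function.update_of_ne (Finset.ne_of_mem_erase hi),
      Function.update_of_ne (Finset.ne_of_mem_erase hi)]
  refine ⟨i₀, le_antisymm (Ideal.span_le.mpr (by rintro _ ⟨i, rfl⟩; exact hmem i)) ?_, ?_⟩
  · have hsub : ∀ i, x i ∈ Ideal.span (Set.range (Function.update x i₀ a)) := by
      have hne : ∀ i, i ≠ i₀ → x i ∈ Ideal.span (Set.range (Function.update x i₀ a)) :=
        fun i hi => Ideal.subset_span ⟨i, Function.update_of_ne hi _ _⟩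
      intro i
      rcases eq_or_ne i i₀ with rfl | hi
      · rw [← Ideal.unit_mul_mem_iff_mem _ hi₀, ha']
        refine sub_mem (Ideal.subset_span ⟨i, Function.update_self _ _ _⟩)
          (Ideal.sum_mem _ fun j hj => Ideal.mul_mem_left _ _ (hne j (Finset.ne_of_mem_erase hj)))
      · exact hne i hi
    conv_lhs => rw [← h.span_eq]
    exact Ideal.span_le.mpr (by rintro _ ⟨i, rfl⟩; exact hsub i)
  · intro r hr
    rw [hsum] at hr
    have h1 := h.mem_of_sum_mem _ hr
    have h2 : r i₀ ∈ I := by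
      have := h1 i₀
      rw [Function.update_self, zero_add, mul_comm] at this
      exact (Ideal.unit_mul_mem_iff_mem _ hi₀).mp this
    intro i
    rcases eq_or_ne i i₀ with rfl | hi
    · exact h2
    · have := h1 i
      rw [Function.update_of_ne hi] at this
      exact (I.add_mem_iff_left (I.mul_mem_right _ h2)).mp this

variable [IsNoetherianRing R]

/-- Lifts of a basis of `I/I²` generate `I` by Nakayama. -/
theorem exists_isCotangentBasis (hI : I ≠ ⊤) [Module.Free (R ⧸ I) I.Cotangent] :
    ∃ (n : ℕ) (x : Fin n → R), IsCotangentBasis I x := by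
  have : Nontrivial (R ⧸ I) := Ideal.Quotient.nontrivial_iff.mpr hI
  have : Module.Finite R I.Cotangent :=
    Module.Finite.of_surjective I.toCotangent I.toCotangent_surjective
  have : Module.Finite (R ⧸ I) I.Cotangent := Module.Finite.of_restrictScalars_finite R _ _
  let β := Module.finBasis (R ⧸ I) I.Cotangent
  choose x hx using fun i => I.toCotangent_surjective (β i)
  have key : ∀ r : Fin _ → R,
      I.toCotangent ⟨∑ i, r i * (x i : R), Ideal.sum_mem _ fun i _ => I.mul_mem_left _ (x i).2⟩ =
      ∑ i, Ideal.Quotient.mk I (r i) • β i := by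
    intro r
    rw [toCotangent_sum fun i => (x i).2]
    exact Finset.sum_congr rfl fun i _ => by rw [hx]
  refine ⟨_, fun i => x i, ?_, ?_⟩
  · have hle : Ideal.span (Set.range fun i => (x i : R)) ≤ I :=
      Ideal.span_le.mpr (by rintro _ ⟨i, rfl⟩; exact (x i).2)
    refine le_antisymm hle ?_
    refine Submodule.le_of_le_smul_of_le_jacobson_bot (I := I) (IsNoetherian.noetherian _)
      ((IsLocalRing.le_maximalIdeal hI).trans
        (IsLocalRing.maximalIdeal_le_jacobson ⊥)) ?_
    intro z hz
    choose r hr using fun i => Ideal.Quotient.mk_surjective (I := I)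
      (β.repr (I.toCotangent ⟨z, hz⟩) i)
    have h1 := key r
    simp only [hr, β.sum_repr] at h1
    rw [Ideal.toCotangent_eq] at h1
    have h2 : z = (∑ i, r i * (x i : R)) + -((∑ i, r i * (x i : R)) - z) := by ring
    rw [h2]
    refine Submodule.add_mem_sup (Ideal.sum_mem _ fun i _ => Ideal.mul_mem_left _ _
      (Ideal.subset_span ⟨i, rfl⟩)) (neg_mem ?_)
    rw [smul_eq_mul, ← pow_two]
    exact h1
  · intro r hr i
    have h1 := key r
    rw [(I.toCotangent_eq_zero _).mpr hr] at h1
    have h2 := Fintype.linearIndependent_iff.mp β.linearIndependent _ h1.symm i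
    exact Ideal.Quotient.eq_zero_iff_mem.mp h2

/-- A reduction generator is not in `𝔪 I`. -/
theorem notMem_maximalIdeal_mul_of_sq_eq {a : R} (ha : a ∈ nonZeroDivisors R) (haI : a ∈ I)
    (hsq : I ^ 2 = Ideal.span {a} * I) : a ∉ maximalIdeal R * I := by
  intro h
  have h1 : I ^ 2 ≤ maximalIdeal R • I ^ 2 := by
    conv_lhs => rw [hsq]
    rw [smul_eq_mul, pow_two, ← mul_assoc]
    exact Ideal.mul_mono_left ((Ideal.span_singleton_le_iff_mem _).mpr h)
  have h2 := Submodule.eq_bot_of_le_smul_of_le_jacobson_bot _ _ (IsNoetherian.noetherian _) h1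
    (IsLocalRing.maximalIdeal_le_jacobson ⊥)
  have h3 : a ^ 2 ∈ I ^ 2 := Ideal.pow_mem_pow haI 2
  rw [h2, Ideal.mem_bot] at h3
  exact nonZeroDivisors.ne_zero (pow_mem ha 2) h3

/-- A basis of the conormal module of `I` containing a given principal reduction `a ≠ I`,
together with an index `i₁` of another basis element. -/
structure IsUlrichBasis (I : Ideal R) (a : R) (x : ι → R) (i₀ i₁ : ι) : Prop extends
    IsCotangentBasis I x where
  apply_eq : x i₀ = a
  ne : i₁ ≠ i₀
  mem_nonZeroDivisors : a ∈ nonZeroDivisors R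
  sq_eq : I ^ 2 = Ideal.span {a} * I
  ne_top : I ≠ ⊤

theorem exists_isUlrichBasis {a : R} (haI : a ∈ I) (ha : a ∈ nonZeroDivisors R)
    (hsq : I ^ 2 = Ideal.span {a} * I) (hne : I ≠ Ideal.span {a}) (hI : I ≠ ⊤)
    [Module.Free (R ⧸ I) I.Cotangent] :
    ∃ (n : ℕ) (x : Fin n → R) (i₀ i₁ : Fin n), IsUlrichBasis I a x i₀ i₁ := by
  obtain ⟨n, x, hx⟩ := exists_isCotangentBasis hI
  obtain ⟨i₀, hx'⟩ := hx.exists_update haI (notMem_maximalIdeal_mul_of_sq_eq ha haI hsq)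
  have : ∃ i₁, i₁ ≠ i₀ := by
    by_contra! hall
    refine hne (le_antisymm ?_ ((Ideal.span_singleton_le_iff_mem _).mpr haI))
    rw [← hx'.span_eq]
    refine Ideal.span_le.mpr ?_
    rintro _ ⟨i, rfl⟩
    rw [hall i, Function.update_self]
    exact Ideal.mem_span_singleton_self a
  obtain ⟨i₁, hi₁⟩ := this
  exact ⟨n, _, i₀, i₁, hx', Function.update_self _ _ _, hi₁, ha, hsq, hI⟩

omit [IsLocalRing R] [IsNoetherianRing R] in
theorem IsUlrichBasis.mem_self {a : R} {i₀ i₁ : ι} (h : IsUlrichBasis I a x i₀ i₁) : a ∈ I :=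
  h.apply_eq ▸ h.mem i₀

omit [IsLocalRing R] [IsNoetherianRing R] in
/-- Coordinates with respect to `x` are unique modulo `I` and up to the coefficient of `a`. -/
theorem IsUlrichBasis.mem_of_sum_mem_span {a : R} {i₀ i₁ : ι} (h : IsUlrichBasis I a x i₀ i₁)
    {r : ι → R} (hr : ∑ i, r i * x i ∈ Ideal.span {a}) {i : ι} (hi : i ≠ i₀) : r i ∈ I := by
  classical
  obtain ⟨t, ht⟩ := Ideal.mem_span_singleton'.mp hr
  have h1 := h.mem_of_sum_mem (r - Pi.single i₀ t) (by
    simp only [Pi.sub_apply, sub_mul, Finset.sum_sub_distrib, ← ht]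
    rw [Finset.sum_eq_single i₀ (fun j _ hj => by rw [Pi.single_eq_of_ne hj, zero_mul])
      (fun hn => absurd (Finset.mem_univ _) hn), Pi.single_eq_same, h.apply_eq, sub_self]
    exact zero_mem _) i
  rwa [Pi.sub_apply, Pi.single_eq_of_ne hi, sub_zero] at h1

-- The membership test used throughout: `x i₁` is part of a basis of the free `R/I`-module `I/(a)`.
omit [IsLocalRing R] [IsNoetherianRing R] in
theorem IsUlrichBasis.mem_of_mul_mem_span {a : R} {i₀ i₁ : ι} (h : IsUlrichBasis I a x i₀ i₁)
    {s : R} (hs : s * x i₁ ∈ Ideal.span {a}) : s ∈ I := by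
  classical
  have h1 := h.mem_of_sum_mem_span (r := Pi.single i₁ s) (by
    rw [Finset.sum_eq_single i₁ (fun j _ hj => by rw [Pi.single_eq_of_ne hj, zero_mul])
      (fun hn => absurd (Finset.mem_univ _) hn), Pi.single_eq_same]
    exact hs) h.ne
  rwa [Pi.single_eq_same] at h1

end CotangentBasis

theorem IsUlrichIdeal.ne_top {R : Type*} [CommRing R] [IsLocalRing R] {I : Ideal R}
    (hI : IsUlrichIdeal I) : I ≠ ⊤ := by
  rintro rfl
  have := hI.radical_eq
  rw [Ideal.radical_top] at this
  exact (maximalIdeal.isMaximal R).ne_top this.symm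

/-- In a ring with an Ulrich ideal, having minimal multiplicity is equivalent to the numerical
condition `r(R) + 1 = e(R)`. -/
theorem IsUlrichIdeal.exists_multiplicity {R : Type*} [CommRing R] [IsLocalRing R]
    [IsNoetherianRing R] {I : Ideal R} (hI : IsUlrichIdeal I) {y : R}
    (hy : y ∈ nonZeroDivisors R) (hym : y ∈ maximalIdeal R) :
    ∃ e : ℕ, Tendsto (hilbertSamuelRatio R) atTop (𝓝 (e : ℝ)) ∧
      (embeddingDim R = e ↔ cmType R + 1 = e) := by
  obtain ⟨a, haI, -, hne, hsq⟩ := hI.exists_parameter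
  obtain ⟨ha, s, hs⟩ := mem_nonZeroDivisors_of_sq_eq hI.radical_eq hsq hy hym
  have := hI.free_cotangent
  obtain ⟨n, x, i₀, i₁, hx⟩ := exists_isUlrichBasis haI ha hsq hne hI.ne_top
  have hIm : I ≤ maximalIdeal R := IsLocalRing.le_maximalIdeal hI.ne_top
  have ham := hIm haI
  obtain ⟨e, k₁, he, hle⟩ := exists_hilbertFunction_eventually_const ha ham hs
  refine ⟨e, tendsto_hilbertSamuelRatio he, ?_⟩
  set 𝔪 := maximalIdeal R
  have hcomm : 𝔪 * Ideal.span {a} ≤ Ideal.span {a} :=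
    Ideal.mul_le_inf.trans inf_le_right
  let D : Ideal R := (Ideal.span {a}).colon (𝔪 : Set R)
  have hD : ∀ z, z ∈ D ↔ ∀ w ∈ 𝔪, w * z ∈ Ideal.span {a} := by
    intro z
    simp only [D, Submodule.mem_colon, smul_eq_mul, SetLike.mem_coe, mul_comm z]
  -- An element of `(a) : 𝔪` lies in `I`, since `x i₁ ∈ 𝔪`. If `w z = t a` with `t` a unit, then `a
  -- ∈ 𝔪I`, which is impossible for a reduction.
  have hD' : ∀ z, z ∈ D ↔ ∀ w ∈ 𝔪, w * z ∈ 𝔪 * Ideal.span {a} := by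
    intro z
    rw [hD]
    refine ⟨fun h w hw => ?_, fun h w hw => hcomm (h w hw)⟩
    have hzI : z ∈ I := hx.mem_of_mul_mem_span (by
      rw [mul_comm]
      exact h _ (hIm (hx.mem i₁)))
    obtain ⟨t, ht⟩ := Ideal.mem_span_singleton'.mp (h w hw)
    rw [← ht]
    refine Ideal.mul_mem_mul ?_ (Ideal.mem_span_singleton_self a)
    by_contra htu
    have htu' : IsUnit t := by
      rwa [mem_maximalIdeal, mem_nonunits_iff, not_not] at htu
    refine notMem_maximalIdeal_mul_of_sq_eq ha haI hsq ?_
    rw [← Ideal.unit_mul_mem_iff_mem _ htu', ht]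
    exact Ideal.mul_mem_mul hw hzI
  have haD : a ∈ D := (hD a).mpr fun w _ => Ideal.mul_mem_left _ _ (Ideal.mem_span_singleton_self a)
  rw [embeddingDim_eq_iff_relLength_colon_eq ha ham hs he hle hD' haD,
    cmType_eq_relLength ha ham hD,
    relLength_add hcomm ((Ideal.span_singleton_le_iff_mem _).mpr haD)]
  -- This is the `1` in `r + 1`: `(a)/a𝔪` is a copy of the residue field.
  have h1 : relLength (Ideal.span {a}) (𝔪 * Ideal.span {a}) = 1 := by
    have h2 := relLength_map_map (mulLeft_injective_of_mem_nonZeroDivisors ha) ⊤ 𝔪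
    rw [map_mulLeft_eq_span_mul, map_mulLeft_eq_span_mul, Ideal.mul_top, mul_comm _ 𝔪] at h2
    rw [h2, relLength_top]
    exact Module.length_eq_one_iff.mpr
      (isSimpleModule_iff_isCoatom.mpr (maximalIdeal.isMaximal R).out)
  rw [h1]

end

noncomputable section

/-! ### Two nested Ulrich ideals compared inside `R`. -/

section UlrichPair

variable {R : Type*} [CommRing R]
  {ι κ : Type*} [Fintype ι] [Fintype κ] {I J : Ideal R} {a b : R}
  {x : ι → R} {i₀ i₁ : ι} {w : κ → R} {j₀ j₁ : κ}

theorem exists_mem_eq_mul_of_sq_eq (hsq : I ^ 2 = Ideal.span {a} * I) {u v : R} (hu : u ∈ I)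
    (hv : v ∈ I) : ∃ t ∈ I, u * v = a * t := by
  have h : u * v ∈ Ideal.span {a} * I := by
    rw [← hsq, pow_two]
    exact Ideal.mul_mem_mul hu hv
  obtain ⟨t, ht, h⟩ := Ideal.mem_span_singleton_mul.mp h
  exact ⟨t, ht, h.symm⟩

/-- If `J = (b)`, then `b² ∈ aJ` with `a ∈ (b)` forces `a` to be a unit times `b`. So any `b` with
`J² = bJ` may serve as the reduction in the basis of `J`. -/
theorem ne_span_singleton_of_sq_eq {b : R} (hb : b ∈ nonZeroDivisors R) (hbJ : b ∈ J)
    (haJ : a ∈ J) (hsq : J ^ 2 = Ideal.span {a} * J) (hne : J ≠ Ideal.span {a}) :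
    J ≠ Ideal.span {b} := by
  intro hJ
  obtain ⟨t, ht, hbb⟩ := exists_mem_eq_mul_of_sq_eq hsq hbJ hbJ
  rw [hJ] at ht haJ
  obtain ⟨u, rfl⟩ := Ideal.mem_span_singleton'.mp haJ
  obtain ⟨v, rfl⟩ := Ideal.mem_span_singleton'.mp ht
  have h1 : (b * b) * (u * v) = (b * b) * 1 := by
    linear_combination -hbb
  have huv : u * v = 1 := (mul_cancel_left_mem_nonZeroDivisors (mul_mem hb hb)).mp h1
  apply hne
  rw [hJ, Ideal.span_singleton_mul_left_unit (IsUnit.of_mul_eq_one v huv)]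

/-- Write `aj = bs`. Multiplying by `x i₁` and using `J² = bJ` again gives `s x i₁ ∈ (a)`, so `s ∈
I`. As `bs ∈ (a)`, freeness puts `b` times each coordinate of `s` away from `i₀` in `I`; the rest of
`aj` then lies in `I² = aI`, and `a` cancels. -/
theorem IsUlrichBasis.exists_coeff (hx : IsUlrichBasis I a x i₀ i₁)
    (hw : IsUlrichBasis J b w j₀ j₁) (hIJ : I ≤ J) {j : R} (hj : j ∈ J) :
    ∃ r : ι → R, a * j = b * ∑ k, r k * x k ∧ (∀ k, k ≠ i₀ → r k * b ∈ I) ∧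
      j - r i₀ * b ∈ I := by
  classical
  obtain ⟨s, -, hs⟩ := exists_mem_eq_mul_of_sq_eq hw.sq_eq (hIJ hx.mem_self) hj
  have hsI : s ∈ I := by
    obtain ⟨t, -, ht⟩ := exists_mem_eq_mul_of_sq_eq hw.sq_eq hj (hIJ (hx.mem i₁))
    refine hx.mem_of_mul_mem_span (Ideal.mem_span_singleton'.mpr ⟨t, ?_⟩)
    refine (mul_cancel_left_mem_nonZeroDivisors hw.mem_nonZeroDivisors).mp ?_
    linear_combination x i₁ * hs - a * ht
  obtain ⟨r, rfl⟩ := hx.exists_sum hsI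
  have hr : ∀ k, k ≠ i₀ → r k * b ∈ I := by
    intro k hk
    refine hx.mem_of_sum_mem_span (r := fun k => r k * b) ?_ hk
    refine Ideal.mem_span_singleton'.mpr ⟨j, ?_⟩
    rw [mul_comm, hs, Finset.mul_sum]
    exact Finset.sum_congr rfl fun k _ => by ring
  refine ⟨r, hs, hr, ?_⟩
  have hmem : a * (j - r i₀ * b) ∈ Ideal.span {a} * I := by
    have : a * (j - r i₀ * b) = ∑ k ∈ Finset.univ.erase i₀, (r k * b) * x k := by
      rw [mul_sub, hs, ← Finset.add_sum_erase _ _ (Finset.mem_univ i₀), hx.apply_eq, mul_add,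
        Finset.mul_sum]
      rw [Finset.sum_congr rfl fun k _ => (by ring : r k * b * x k = b * (r k * x k))]
      ring
    rw [this, ← hx.sq_eq, pow_two]
    exact Ideal.sum_mem _ fun k hk =>
      Ideal.mul_mem_mul (hr k (Finset.ne_of_mem_erase hk)) (hx.mem k)
  obtain ⟨t, ht, h⟩ := Ideal.mem_span_singleton_mul.mp hmem
  rwa [← (mul_cancel_left_mem_nonZeroDivisors hx.mem_nonZeroDivisors).mp h]

theorem IsUlrichBasis.exists_sub_mem (hx : IsUlrichBasis I a x i₀ i₁)
    (hw : IsUlrichBasis J b w j₀ j₁) (hIJ : I ≤ J) {j : R} (hj : j ∈ J) :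
    ∃ r, j - r * b ∈ I :=
  let ⟨r, _, _, h⟩ := hx.exists_coeff hw hIJ hj
  ⟨r i₀, h⟩

/-- When `j` is itself in `I`, the coordinate at `i₀` also lies in `I : b`, so all of them do. -/
theorem IsUlrichBasis.exists_mul_eq (hx : IsUlrichBasis I a x i₀ i₁)
    (hw : IsUlrichBasis J b w j₀ j₁) (hIJ : I ≤ J) {i : R} (hi : i ∈ I) :
    ∃ s ∈ I.colon {b} * I, a * i = b * s := by
  obtain ⟨r, h, hr, h₀⟩ := hx.exists_coeff hw hIJ (hIJ hi)
  refine ⟨_, Ideal.sum_mem _ fun k _ => Ideal.mul_mem_mul ?_ (hx.mem k), h⟩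
  rw [Submodule.mem_colon_singleton, smul_eq_mul]
  rcases eq_or_ne k i₀ with rfl | hk
  · simpa using sub_mem hi h₀
  · exact hr k hk

/-- `I² ⊆ b (I : b) I`. -/
theorem IsUlrichBasis.exists_mul_mul_eq (hx : IsUlrichBasis I a x i₀ i₁)
    (hw : IsUlrichBasis J b w j₀ j₁) (hIJ : I ≤ J) {u v : R} (hu : u ∈ I) (hv : v ∈ I) :
    ∃ s ∈ I.colon {b} * I, u * v = b * s := by
  obtain ⟨t, ht, h⟩ := exists_mem_eq_mul_of_sq_eq hx.sq_eq hu hv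
  rw [h]
  exact hx.exists_mul_eq hw hIJ ht

theorem IsUlrichBasis.notMem_of_lt (hx : IsUlrichBasis I a x i₀ i₁)
    (hw : IsUlrichBasis J b w j₀ j₁) (hIJ : I < J) : b ∉ I := by
  intro hb
  refine hIJ.not_ge fun j hj => ?_
  obtain ⟨r, hr⟩ := hx.exists_sub_mem hw hIJ.le hj
  simpa using add_mem hr (I.mul_mem_left r hb)

theorem IsUlrichBasis.colon_le [IsLocalRing R] (hx : IsUlrichBasis I a x i₀ i₁)
    (hw : IsUlrichBasis J b w j₀ j₁) (hIJ : I < J) : I.colon {b} ≤ maximalIdeal R := by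
  refine IsLocalRing.le_maximalIdeal fun h => hx.notMem_of_lt hw hIJ ?_
  have h1 : (1 : R) ∈ I.colon {b} := h ▸ Submodule.mem_top
  simpa [Submodule.mem_colon_singleton] using h1

/-- Test membership in `J` against `w j₁`, which is `rb` plus some `i ∈ I`. Here `ai = bs` with `s ∈
𝔪I`, so `zs ∈ I² = aI`; cancelling `a` gives `zi ∈ (b)`. -/
theorem IsUlrichBasis.mem_of_forall_mul_mem [IsLocalRing R] (hx : IsUlrichBasis I a x i₀ i₁)
    (hw : IsUlrichBasis J b w j₀ j₁) (hIJ : I < J) {z : R}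
    (hz : ∀ m ∈ maximalIdeal R, m * z ∈ I) : z ∈ J := by
  refine hw.mem_of_mul_mem_span ?_
  obtain ⟨r, hr⟩ := hx.exists_sub_mem hw hIJ.le (hw.mem j₁)
  obtain ⟨s, hs, h⟩ := hx.exists_mul_eq hw hIJ.le hr
  have hzs : z * s ∈ I ^ 2 := by
    rw [pow_two, ← smul_eq_mul z s]
    refine Submodule.mul_induction_on hs (fun p hp q hq => ?_) (fun p q hp hq => ?_)
    · rw [smul_eq_mul, ← mul_assoc, mul_comm z]
      exact Ideal.mul_mem_mul (hz p (hx.colon_le hw hIJ hp)) hq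
    · rw [smul_add]
      exact add_mem hp hq
  rw [hx.sq_eq] at hzs
  obtain ⟨t, -, ht⟩ := Ideal.mem_span_singleton_mul.mp hzs
  refine Ideal.mem_span_singleton'.mpr ⟨t + z * r, ?_⟩
  refine (mul_cancel_left_mem_nonZeroDivisors hx.mem_nonZeroDivisors).mp ?_
  linear_combination b * ht - z * h

/-- If `s b = a t` with `s ∈ I`, then `t ∈ J`. -/
theorem IsUlrichBasis.mem_of_mul_eq (hx : IsUlrichBasis I a x i₀ i₁)
    (hw : IsUlrichBasis J b w j₀ j₁) (hIJ : I ≤ J) {s t : R} (hs : s ∈ I) (h : s * b = a * t) :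
    t ∈ J := by
  -- With `w j₁ = rb + i` and `i ∈ I`, the product `s i` lies in `I² = aI`, so `a` cancels from `a t
  -- w j₁ = s b w j₁`.
  refine hw.mem_of_mul_mem_span ?_
  obtain ⟨r, hr⟩ := hx.exists_sub_mem hw hIJ (hw.mem j₁)
  obtain ⟨u, -, hu⟩ := exists_mem_eq_mul_of_sq_eq hx.sq_eq hs hr
  refine Ideal.mem_span_singleton'.mpr ⟨u + t * r, ?_⟩
  refine (mul_cancel_left_mem_nonZeroDivisors hx.mem_nonZeroDivisors).mp ?_
  linear_combination (w j₁ - r * b) * h - b * hu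

end UlrichPair

end

noncomputable section

/-! ### The ring `B = J : J` and its Ulrich ideal `𝔞 = I/b`. -/

section Blowup

variable {R B : Type*} [CommRing R] [CommRing B] [Algebra R B]
  {ι κ : Type*} [Fintype ι] [Fintype κ] {I J : Ideal R} {a b : R}
  {x : ι → R} {i₀ i₁ : ι} {w : κ → R} {j₀ j₁ : κ} {T : B →ₗ[R] R} {𝔞 : Ideal B}

/-- An `R`-algebra `B` with an isomorphism `T` from `B` to the ideal `J` which behaves as the
multiplication by `b ∈ J` on the ring `J : J = b⁻¹ J`. -/
structure IsMulEndColon (J : Ideal R) (b : R) (T : B →ₗ[R] R) : Prop where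
  injective : Function.Injective T
  range_eq : LinearMap.range T = J
  map_one : T 1 = b
  map_mul : ∀ u v, T u * T v = b * T (u * v)

theorem IsMulEndColon.mem (hT : IsMulEndColon J b T) (z : B) : T z ∈ J :=
  hT.range_eq ▸ LinearMap.mem_range_self T z

theorem IsMulEndColon.exists_eq (hT : IsMulEndColon J b T) {j : R} (hj : j ∈ J) :
    ∃ z, T z = j := by
  rwa [← hT.range_eq] at hj

theorem IsMulEndColon.map_algebraMap (hT : IsMulEndColon J b T) (r : R) :
    T (algebraMap R B r) = r * b := by
  rw [Algebra.algebraMap_eq_smul_one, map_smul, hT.map_one, smul_eq_mul]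

theorem IsMulEndColon.map_algebraMap_mul (r : R) (z : B) :
    T (algebraMap R B r * z) = r * T z := by
  rw [← Algebra.smul_def, map_smul, smul_eq_mul]

theorem IsMulEndColon.algebraMap_mul (hT : IsMulEndColon J b T) (z : B) :
    algebraMap R B b * z = algebraMap R B (T z) := by
  apply hT.injective
  rw [map_algebraMap_mul, hT.map_algebraMap, mul_comm]

theorem IsMulEndColon.algebraMap_mem_nonZeroDivisors (hT : IsMulEndColon J b T) {r : R}
    (hr : r ∈ nonZeroDivisors R) : algebraMap R B r ∈ nonZeroDivisors B := by
  refine mem_nonZeroDivisors_iff_right.mpr fun z hz => hT.injective ?_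
  rw [map_zero]
  refine (mem_nonZeroDivisors_iff_right.mp hr) _ ?_
  rw [mul_comm, ← map_algebraMap_mul, mul_comm, hz, map_zero]

theorem IsMulEndColon.finite [IsNoetherianRing R] (hT : IsMulEndColon J b T) :
    Module.Finite R B :=
  Module.Finite.of_injective T hT.injective

variable [IsLocalRing R] [IsNoetherianRing R]

/-- An Ulrich ideal `J` with a reduction `b`, an Ulrich ideal `I ⊊ J` with a reduction `a`, bases
of their conormal modules, and the ideal `𝔞 = b⁻¹ I` of the ring `B = J : J`. -/
structure IsUlrichBlowup (I J : Ideal R) (a b : R) (x : ι → R) (i₀ i₁ : ι) (w : κ → R)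
    (j₀ j₁ : κ) (T : B →ₗ[R] R) (𝔞 : Ideal B) : Prop where
  left : IsUlrichBasis I a x i₀ i₁
  right : IsUlrichBasis J b w j₀ j₁
  lt : I < J
  toIsMulEndColon : IsMulEndColon J b T
  mem_iff : ∀ z, z ∈ 𝔞 ↔ T z ∈ I

-- Closure of `I/b` under `B` follows from `J = I + (b)` and `I² ⊆ b(I : b)I`: the part of `T y` in
-- `I` contributes an element of `I²`, from which `b` can be cancelled.
omit [IsLocalRing R] [IsNoetherianRing R] in
theorem exists_isUlrichBlowup (hx : IsUlrichBasis I a x i₀ i₁) (hw : IsUlrichBasis J b w j₀ j₁)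
    (hIJ : I < J) (hT : IsMulEndColon J b T) :
    ∃ 𝔞 : Ideal B, IsUlrichBlowup I J a b x i₀ i₁ w j₀ j₁ T 𝔞 := by
  refine ⟨{ carrier := {z | T z ∈ I}
            add_mem' := fun hu hv => ?_
            zero_mem' := ?_
            smul_mem' := fun y z hz => ?_ }, hx, hw, hIJ, hT, fun z => Iff.rfl⟩
  · rw [Set.mem_ofPred_eq, map_add]
    exact add_mem hu hv
  · rw [Set.mem_ofPred_eq, map_zero]
    exact zero_mem _
  · rw [Set.mem_ofPred_eq] at hz ⊢
    obtain ⟨r, hr⟩ := hx.exists_sub_mem hw hIJ.le (hT.mem y)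
    obtain ⟨s, hs, h⟩ := hx.exists_mul_mul_eq hw hIJ.le hr hz
    have h1 : T (y * z) = r * T z + s := by
      refine (mul_cancel_left_mem_nonZeroDivisors hw.mem_nonZeroDivisors).mp ?_
      linear_combination h - hT.map_mul y z
    rw [smul_eq_mul, h1]
    exact add_mem (I.mul_mem_left _ hz) (Ideal.mul_le_inf.trans inf_le_right hs)

namespace IsUlrichBlowup

omit [IsNoetherianRing R] in
theorem param_mem (h : IsUlrichBlowup I J a b x i₀ i₁ w j₀ j₁ T 𝔞) : b ∈ maximalIdeal R :=
  IsLocalRing.le_maximalIdeal h.right.ne_top h.right.mem_self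

omit [IsLocalRing R] [IsNoetherianRing R] in
theorem algebraMap_mem_iff (h : IsUlrichBlowup I J a b x i₀ i₁ w j₀ j₁ T 𝔞) (r : R) :
    algebraMap R B r ∈ 𝔞 ↔ r * b ∈ I := by
  rw [h.mem_iff, h.toIsMulEndColon.map_algebraMap]

omit [IsLocalRing R] [IsNoetherianRing R] in
theorem exists_sub_algebraMap_mem (h : IsUlrichBlowup I J a b x i₀ i₁ w j₀ j₁ T 𝔞) (z : B) :
    ∃ r : R, z - algebraMap R B r ∈ 𝔞 := by
  obtain ⟨r, hr⟩ := h.left.exists_sub_mem h.right h.lt.le (h.toIsMulEndColon.mem z)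
  refine ⟨r, ?_⟩
  rwa [h.mem_iff, map_sub, h.toIsMulEndColon.map_algebraMap]

omit [IsLocalRing R] [IsNoetherianRing R] in
theorem map_mem_of_mem_sq (h : IsUlrichBlowup I J a b x i₀ i₁ w j₀ j₁ T 𝔞) {z : B}
    (hz : z ∈ 𝔞 ^ 2) : T z ∈ I.colon {b} * I := by
  rw [pow_two] at hz
  refine Submodule.mul_induction_on hz (fun u hu v hv => ?_) (fun u v hu hv => ?_)
  · obtain ⟨s, hs, hs'⟩ := h.left.exists_mul_mul_eq h.right h.lt.le ((h.mem_iff u).mp hu)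
      ((h.mem_iff v).mp hv)
    rw [h.toIsMulEndColon.map_mul] at hs'
    rwa [(mul_cancel_left_mem_nonZeroDivisors h.right.mem_nonZeroDivisors).mp hs']
  · rw [map_add]
    exact add_mem hu hv

omit [IsLocalRing R] [IsNoetherianRing R] in
theorem mem_map_mul (h : IsUlrichBlowup I J a b x i₀ i₁ w j₀ j₁ T 𝔞) {L : Ideal R} {z : B}
    (hz : T z ∈ L * I) : z ∈ L.map (algebraMap R B) * 𝔞 := by
  suffices ∃ z' ∈ L.map (algebraMap R B) * 𝔞, T z' = T z by
    obtain ⟨z', hz', hzz⟩ := this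
    rwa [← h.toIsMulEndColon.injective hzz]
  refine Submodule.mul_induction_on hz (fun r hr i hi => ?_) (fun u v hu hv => ?_)
  · obtain ⟨z, rfl⟩ := h.toIsMulEndColon.exists_eq (h.lt.le hi)
    exact ⟨_, Ideal.mul_mem_mul (Ideal.mem_map_of_mem _ hr) ((h.mem_iff z).mpr hi),
      IsMulEndColon.map_algebraMap_mul r z⟩
  · obtain ⟨u', hu', rfl⟩ := hu
    obtain ⟨v', hv', rfl⟩ := hv
    exact ⟨_, add_mem hu' hv', map_add _ _ _⟩

omit [IsNoetherianRing R] in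
theorem sq_le (h : IsUlrichBlowup I J a b x i₀ i₁ w j₀ j₁ T 𝔞) :
    𝔞 ^ 2 ≤ (maximalIdeal R).map (algebraMap R B) * 𝔞 := fun _ hz =>
  h.mem_map_mul (Ideal.mul_mono_left (h.left.colon_le h.right h.lt) (h.map_mem_of_mem_sq hz))

omit [IsNoetherianRing R] in
theorem nontrivial (h : IsUlrichBlowup I J a b x i₀ i₁ w j₀ j₁ T 𝔞) : Nontrivial B := by
  refine ⟨1, 0, fun h10 => ?_⟩
  have h1 := h.toIsMulEndColon.map_one
  rw [h10, map_zero] at h1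
  exact nonZeroDivisors.ne_zero h.right.mem_nonZeroDivisors h1.symm

/-- By integrality `M` lies over `𝔪`, so it contains `𝔪B ⊇ 𝔞²` and hence `𝔞`; the rest follows from
`B = R + 𝔞`. -/
theorem eq_of_isMaximal (h : IsUlrichBlowup I J a b x i₀ i₁ w j₀ j₁ T 𝔞) {M : Ideal B}
    (hM : M.IsMaximal) : M = (maximalIdeal R).map (algebraMap R B) ⊔ 𝔞 := by
  have := h.toIsMulEndColon.finite
  have hc : M.comap (algebraMap R B) = maximalIdeal R :=
    IsLocalRing.eq_maximalIdeal (Ideal.isMaximal_comap_of_isIntegral_of_isMaximal M)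
  have h1 : (maximalIdeal R).map (algebraMap R B) ≤ M := Ideal.map_le_iff_le_comap.mpr hc.ge
  have h2 : 𝔞 ≤ M := fun z hz => hM.isPrime.mem_of_pow_mem 2
    (h1 (Ideal.mul_le_inf.trans inf_le_left (h.sq_le (Ideal.pow_mem_pow hz 2))))
  refine le_antisymm (fun z hz => ?_) (sup_le h1 h2)
  obtain ⟨r, hr⟩ := h.exists_sub_algebraMap_mem z
  have hr' : r ∈ maximalIdeal R := by
    rw [← hc, Ideal.mem_comap]
    simpa using sub_mem hz (h2 hr)
  rw [← add_sub_cancel (algebraMap R B r) z]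
  exact Submodule.add_mem_sup (Ideal.mem_map_of_mem _ hr') hr

theorem isLocalRing (h : IsUlrichBlowup I J a b x i₀ i₁ w j₀ j₁ T 𝔞) : IsLocalRing B := by
  have := h.nontrivial
  obtain ⟨M, hM⟩ := Ideal.exists_maximal B
  exact IsLocalRing.of_unique_max_ideal
    ⟨M, hM, fun N hN => (h.eq_of_isMaximal hN).trans (h.eq_of_isMaximal hM).symm⟩

omit [IsLocalRing R] in
theorem isNoetherianRing (h : IsUlrichBlowup I J a b x i₀ i₁ w j₀ j₁ T 𝔞) :
    IsNoetherianRing B := by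
  have := h.toIsMulEndColon.finite
  exact IsNoetherianRing.of_finite R B

variable [IsLocalRing B]

theorem maximalIdeal_eq (h : IsUlrichBlowup I J a b x i₀ i₁ w j₀ j₁ T 𝔞) :
    maximalIdeal B = (maximalIdeal R).map (algebraMap R B) ⊔ 𝔞 :=
  h.eq_of_isMaximal (maximalIdeal.isMaximal B)

theorem algebraMap_mem_maximalIdeal_iff (h : IsUlrichBlowup I J a b x i₀ i₁ w j₀ j₁ T 𝔞) (r : R) :
    algebraMap R B r ∈ maximalIdeal B ↔ r ∈ maximalIdeal R := by
  have := h.toIsMulEndColon.finite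
  rw [← Ideal.mem_comap, IsLocalRing.eq_maximalIdeal
    (Ideal.isMaximal_comap_of_isIntegral_of_isMaximal (maximalIdeal B))]

theorem isLocalHom (h : IsUlrichBlowup I J a b x i₀ i₁ w j₀ j₁ T 𝔞) :
    IsLocalHom (algebraMap R B) := by
  refine ⟨fun r hr => ?_⟩
  by_contra hu
  exact (h.algebraMap_mem_maximalIdeal_iff r).mpr hu hr

theorem mem_maximalIdeal_iff (h : IsUlrichBlowup I J a b x i₀ i₁ w j₀ j₁ T 𝔞) {z : B} :
    z ∈ maximalIdeal B ↔ ∃ r ∈ maximalIdeal R, z - algebraMap R B r ∈ 𝔞 := by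
  have ha : 𝔞 ≤ maximalIdeal B := by
    rw [h.maximalIdeal_eq]
    exact le_sup_right
  constructor
  · intro hz
    obtain ⟨r, hr⟩ := h.exists_sub_algebraMap_mem z
    refine ⟨r, (h.algebraMap_mem_maximalIdeal_iff r).mp ?_, hr⟩
    simpa using sub_mem hz (ha hr)
  · rintro ⟨r, hr, hz⟩
    simpa using add_mem (ha hz) ((h.algebraMap_mem_maximalIdeal_iff r).mpr hr)

theorem residue_surjective (h : IsUlrichBlowup I J a b x i₀ i₁ w j₀ j₁ T 𝔞) :
    Function.Surjective (algebraMap R (ResidueField B)) := by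
  intro z
  obtain ⟨z, rfl⟩ := IsLocalRing.residue_surjective z
  obtain ⟨r, hr⟩ := h.exists_sub_algebraMap_mem z
  refine ⟨r, ?_⟩
  rw [IsScalarTower.algebraMap_apply R B (ResidueField B)]
  change residue B _ = residue B z
  rw [eq_comm, ← sub_eq_zero, ← map_sub, residue_eq_zero_iff, h.maximalIdeal_eq]
  exact Ideal.mem_sup_right hr

theorem nonempty_residueField_algEquiv (h : IsUlrichBlowup I J a b x i₀ i₁ w j₀ j₁ T 𝔞) :
    Nonempty (ResidueField R ≃ₐ[R] ResidueField B) := by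
  have hk : maximalIdeal R = RingHom.ker (Algebra.ofId R (ResidueField B)) := by
    ext r
    rw [RingHom.mem_ker, Algebra.ofId_apply, IsScalarTower.algebraMap_apply R B (ResidueField B)]
    change _ ↔ residue B _ = 0
    rw [residue_eq_zero_iff, h.algebraMap_mem_maximalIdeal_iff]
  exact ⟨(Ideal.quotientEquivAlgOfEq R hk).trans
    (Ideal.quotientKerAlgEquivOfSurjective (f := Algebra.ofId R (ResidueField B))
      h.residue_surjective)⟩

theorem maximalIdeal_sq_le (h : IsUlrichBlowup I J a b x i₀ i₁ w j₀ j₁ T 𝔞) :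
    maximalIdeal B ^ 2 ≤ (maximalIdeal R).map (algebraMap R B) * maximalIdeal B := by
  conv_lhs => rw [pow_two, h.maximalIdeal_eq, Ideal.sup_mul, ← h.maximalIdeal_eq]
  refine sup_le le_rfl ?_
  rw [h.maximalIdeal_eq, Ideal.mul_sup, Ideal.mul_sup, mul_comm 𝔞, ← pow_two]
  exact sup_le le_sup_right (h.sq_le.trans le_sup_right)

theorem maximalIdeal_pow_succ_le (h : IsUlrichBlowup I J a b x i₀ i₁ w j₀ j₁ T 𝔞) (k : ℕ) :
    maximalIdeal B ^ (k + 1) ≤ (maximalIdeal R ^ k).map (algebraMap R B) * maximalIdeal B := by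
  induction k with
  | zero => simp [Ideal.map_top, Ideal.one_eq_top]
  | succ k ih =>
    rw [pow_succ _ (k + 1)]
    refine (Ideal.mul_mono_left ih).trans ?_
    rw [mul_assoc, ← pow_two, pow_succ _ k, Ideal.map_mul, mul_assoc]
    exact Ideal.mul_mono_right h.maximalIdeal_sq_le

theorem exists_maximalIdeal_pow_le_span (h : IsUlrichBlowup I J a b x i₀ i₁ w j₀ j₁ T 𝔞) {r : R}
    {s : ℕ} (hs : maximalIdeal R ^ s ≤ Ideal.span {r}) :
    maximalIdeal B ^ (s + 1) ≤ Ideal.span {algebraMap R B r} := by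
  refine (h.maximalIdeal_pow_succ_le s).trans (Ideal.mul_le_inf.trans (inf_le_left.trans ?_))
  refine (Ideal.map_mono hs).trans ?_
  rw [Ideal.map_span, Set.image_singleton]

theorem isCohenMacaulayLocalRing (h : IsUlrichBlowup I J a b x i₀ i₁ w j₀ j₁ T 𝔞) {s : ℕ}
    (hs : maximalIdeal R ^ s ≤ Ideal.span {b}) :
    IsCohenMacaulayLocalRing B ∧ ringKrullDim B = 1 := by
  have := h.isNoetherianRing
  exact isCohenMacaulayLocalRing_and_ringKrullDim_eq_one
    (h.toIsMulEndColon.algebraMap_mem_nonZeroDivisors h.right.mem_nonZeroDivisors)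
    ((h.algebraMap_mem_maximalIdeal_iff b).mpr h.param_mem) (h.exists_maximalIdeal_pow_le_span hs)

omit [IsLocalRing R] [IsNoetherianRing R] [IsLocalRing B] in
theorem ne_top (h : IsUlrichBlowup I J a b x i₀ i₁ w j₀ j₁ T 𝔞) : 𝔞 ≠ ⊤ := by
  intro htop
  refine h.left.notMem_of_lt h.right h.lt ?_
  rw [← h.toIsMulEndColon.map_one, ← h.mem_iff, htop]
  exact Submodule.mem_top

-- Modulo `𝔞`, coefficients may be taken in `R`. A relation in `𝔞²` becomes one in `(I : b)I`, so
-- these coefficients lie in `I + (I : b) = I : b`, the contraction of `𝔞` to `R`.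
omit [IsLocalRing R] [IsNoetherianRing R] [IsLocalRing B] in
theorem isCotangentBasis (h : IsUlrichBlowup I J a b x i₀ i₁ w j₀ j₁ T 𝔞) {ξ : ι → B}
    (hξ : ∀ i, T (ξ i) = x i) : IsCotangentBasis 𝔞 ξ := by
  have hT := h.toIsMulEndColon
  have hmem : ∀ i, ξ i ∈ 𝔞 := fun i => (h.mem_iff _).mpr (hξ i ▸ h.left.mem i)
  have hsum : ∀ r : ι → R, T (∑ i, algebraMap R B (r i) * ξ i) = ∑ i, r i * x i := fun r => by
    simp only [map_sum, IsMulEndColon.map_algebraMap_mul, hξ]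
  refine ⟨le_antisymm (Ideal.span_le.mpr (by rintro _ ⟨i, rfl⟩; exact hmem i)) fun z hz => ?_,
    fun β hβ i => ?_⟩
  · obtain ⟨r, hr⟩ := h.left.exists_sum ((h.mem_iff z).mp hz)
    rw [← hsum] at hr
    rw [hT.injective hr]
    exact Ideal.sum_mem _ fun i _ => Ideal.mul_mem_left _ _ (Ideal.subset_span ⟨i, rfl⟩)
  · choose r hr using fun i => h.exists_sub_algebraMap_mem (β i)
    have h1 : ∑ i, algebraMap R B (r i) * ξ i ∈ 𝔞 ^ 2 := by
      have h2 : ∑ i, algebraMap R B (r i) * ξ i =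
          ∑ i, β i * ξ i - ∑ i, (β i - algebraMap R B (r i)) * ξ i := by
        rw [← Finset.sum_sub_distrib]
        exact Finset.sum_congr rfl fun i _ => by ring
      rw [h2]
      refine sub_mem hβ (Ideal.sum_mem _ fun i _ => ?_)
      rw [pow_two]
      exact Ideal.mul_mem_mul (hr i) (hmem i)
    have h3 := h.map_mem_of_mem_sq h1
    rw [hsum] at h3
    obtain ⟨r', hr', hrr⟩ := h.left.exists_sum_of_mem_mul h3
    have h4 := h.left.mem_of_sum_mem (r - r') (by
      simp only [Pi.sub_apply, sub_mul, Finset.sum_sub_distrib, hrr, sub_self]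
      exact zero_mem _) i
    have h5 : r i * b ∈ I := by
      have h6 := hr' i
      rw [Submodule.mem_colon_singleton, smul_eq_mul] at h6
      have h7 : r i * b = (r i - r' i) * b + r' i * b := by ring
      rw [h7]
      exact add_mem (I.mul_mem_right _ h4) h6
    rw [← sub_add_cancel (β i) (algebraMap R B (r i))]
    exact add_mem (hr i) ((h.algebraMap_mem_iff _).mpr h5)

theorem isUlrichIdeal (h : IsUlrichBlowup I J a b x i₀ i₁ w j₀ j₁ T 𝔞) {s : ℕ}
    (hs : maximalIdeal R ^ s ≤ Ideal.span {a}) :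
    IsUlrichIdeal 𝔞 ∧ 𝔞.spanFinrank = Fintype.card ι := by
  have hT := h.toIsMulEndColon
  choose ξ hξ using fun i => hT.exists_eq (h.lt.le (h.left.mem i))
  have hbasis := h.isCotangentBasis hξ
  -- Thus `ξ i₀ = a/b`, which will generate the reduction of `𝔞`.
  have hα : T (ξ i₀) = a := (hξ i₀).trans h.left.apply_eq
  have hle : 𝔞 ≤ maximalIdeal B := IsLocalRing.le_maximalIdeal h.ne_top
  have hαle : Ideal.span {ξ i₀} ≤ 𝔞 := (Ideal.span_singleton_le_iff_mem _).mpr (hbasis.mem i₀)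
  have hrad : maximalIdeal B ≤ (Ideal.span {ξ i₀}).radical := by
    intro z hz
    refine ⟨s + 1, ?_⟩
    refine Ideal.span_singleton_le_span_singleton.mpr ?_
      (h.exists_maximalIdeal_pow_le_span hs (Ideal.pow_mem_pow hz _))
    exact ⟨algebraMap R B b, by rw [mul_comm, hT.algebraMap_mul, hα]⟩
  have hprime : (maximalIdeal B).radical = maximalIdeal B :=
    (maximalIdeal.isMaximal B).isPrime.radical
  refine ⟨⟨?_, ⟨ξ i₀, hbasis.mem i₀, ?_, ?_, ?_⟩, ?_⟩, hbasis.spanFinrank_eq h.ne_top⟩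
  · exact le_antisymm ((Ideal.radical_mono hle).trans hprime.le)
      (hrad.trans (Ideal.radical_mono hαle))
  · exact le_antisymm ((Ideal.radical_mono (hαle.trans hle)).trans hprime.le) hrad
  -- If `a/b` generated `𝔞`, then `b x i₁ ∈ (a)`, and the membership test would put `b` in `I`.
  · intro heq
    have h1 := hbasis.mem i₁
    rw [heq] at h1
    obtain ⟨β, hβ⟩ := Ideal.mem_span_singleton'.mp h1
    refine h.left.notMem_of_lt h.right h.lt (h.left.mem_of_mul_mem_span ?_)
    rw [← hξ i₁, ← hβ, ← hT.map_mul, hα]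
    exact Ideal.mul_mem_left _ _ (Ideal.mem_span_singleton_self a)
  · refine le_antisymm ?_ ?_
    · rw [pow_two, Ideal.mul_le]
      intro u hu v hv
      obtain ⟨t, ht, huv⟩ := exists_mem_eq_mul_of_sq_eq h.left.sq_eq ((h.mem_iff u).mp hu)
        ((h.mem_iff v).mp hv)
      obtain ⟨z, rfl⟩ := hT.exists_eq (h.lt.le ht)
      refine Ideal.mem_span_singleton_mul.mpr ⟨z, (h.mem_iff z).mpr ht, hT.injective ?_⟩
      refine (mul_cancel_left_mem_nonZeroDivisors h.right.mem_nonZeroDivisors).mp ?_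
      rw [← hT.map_mul, ← hT.map_mul, huv, hα]
    · rw [pow_two]
      exact Ideal.mul_mono_left hαle
  · exact Module.Free.of_basis hbasis.basis

end IsUlrichBlowup

end Blowup

end

noncomputable section

/-! ### Lengths over `R` and over `B`. -/

section RestrictScalars

variable {R B : Type*} [CommRing R] [CommRing B] [Algebra R B] [IsLocalRing R] [IsLocalRing B]
  [IsLocalHom (algebraMap R B)]

/-- Relative lengths over `R` and `B` agree if the residue fields agree. -/
theorem relLength_restrictScalars {V : Type*} [AddCommGroup V] [Module R V] [Module B V]
    [IsScalarTower R B V] (e : ResidueField R ≃ₐ[R] ResidueField B) (N N' : Submodule B V) :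
    relLength (N.restrictScalars R) (N'.restrictScalars R) = relLength N N' := by
  have h1 : Module.length (ResidueField R) (ResidueField B) = 1 := by
    rw [← Module.length_eq_of_surjective (S := R) IsLocalRing.residue_surjective,
      ← e.toLinearEquiv.length_eq]
    exact Module.length_eq_one_iff.mpr
      (isSimpleModule_iff_isCoatom.mpr (maximalIdeal.isMaximal R).out)
  have h2 := IsLocalRing.length_restrictScalars R B (N.map N'.mkQ)
  rw [h1, mul_one] at h2
  unfold relLength at *
  rw [← h2]
  refine (length_map_eq_relLength (N'.mkQ.restrictScalars R) (N.restrictScalars R)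
    (N'.restrictScalars R) ?_).symm.trans ?_
  · congr 1
    ext z
    simp
  · rfl

end RestrictScalars

/-! ### Type and multiplicity of `B`. -/

namespace IsUlrichBlowup

variable {R B : Type*} [CommRing R] [CommRing B] [Algebra R B]
  {ι κ : Type*} [Fintype ι] [Fintype κ] {I J : Ideal R} {a b : R}
  {x : ι → R} {i₀ i₁ : ι} {w : κ → R} {j₀ j₁ : κ} {T : B →ₗ[R] R} {𝔞 : Ideal B}
  [IsLocalRing R] [IsNoetherianRing R] [IsLocalRing B]

-- Multiplying by `a/b ∈ 𝔞` shows that `z` is a multiple of `b`, and `bB = J` lies in `R`;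
-- multiplying by `x i₁ / b` and applying the membership test puts it in `I`.
omit [IsLocalRing R] [IsNoetherianRing R] [IsLocalRing B] in
theorem exists_eq_algebraMap (h : IsUlrichBlowup I J a b x i₀ i₁ w j₀ j₁ T 𝔞) {z : B}
    (hz : ∀ v ∈ 𝔞, v * z ∈ Ideal.span {algebraMap R B a}) :
    ∃ s ∈ I, algebraMap R B s = z := by
  have hT := h.toIsMulEndColon
  have ha𝔞 : a ∈ I := h.left.mem_self
  obtain ⟨α, hα⟩ := hT.exists_eq (h.lt.le ha𝔞)
  obtain ⟨ξ, hξ⟩ := hT.exists_eq (h.lt.le (h.left.mem i₁))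
  obtain ⟨β, hβ⟩ := Ideal.mem_span_singleton'.mp (hz α ((h.mem_iff α).mpr (hα ▸ ha𝔞)))
  have hz' : algebraMap R B (T β) = z := by
    rw [← hT.algebraMap_mul]
    refine (mul_cancel_left_mem_nonZeroDivisors
      (hT.algebraMap_mem_nonZeroDivisors h.left.mem_nonZeroDivisors)).mp ?_
    have h1 := hT.algebraMap_mul α
    rw [hα] at h1
    linear_combination (algebraMap R B b) * hβ + z * h1
  refine ⟨T β, h.left.mem_of_mul_mem_span ?_, hz'⟩
  obtain ⟨γ, hγ⟩ := Ideal.mem_span_singleton'.mp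
    (hz ξ ((h.mem_iff ξ).mpr (hξ ▸ h.left.mem i₁)))
  refine Ideal.mem_span_singleton'.mpr ⟨T γ, ?_⟩
  rw [mul_comm, ← IsMulEndColon.map_algebraMap_mul, mul_comm _ γ, hγ, ← hz', mul_comm ξ,
    IsMulEndColon.map_algebraMap_mul, hξ]

/-- The socle of `B / aB` is isomorphic to the socle of `R / aR`. -/
theorem cmType_eq (h : IsUlrichBlowup I J a b x i₀ i₁ w j₀ j₁ T 𝔞) : cmType B = cmType R := by
  have hT := h.toIsMulEndColon
  have hIm : I ≤ maximalIdeal R := IsLocalRing.le_maximalIdeal h.left.ne_top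
  have := h.isLocalHom
  have := h.isNoetherianRing
  obtain ⟨e⟩ := h.nonempty_residueField_algEquiv
  let D : Ideal R := (Ideal.span {a}).colon (maximalIdeal R : Set R)
  have hD : ∀ z, z ∈ D ↔ ∀ w ∈ maximalIdeal R, w * z ∈ Ideal.span {a} := by
    intro z
    simp only [D, Submodule.mem_colon, smul_eq_mul, SetLike.mem_coe, mul_comm z]
  let D' : Ideal B := (Ideal.span {algebraMap R B a}).colon (maximalIdeal B : Set B)
  have hD' : ∀ z, z ∈ D' ↔ ∀ w ∈ maximalIdeal B, w * z ∈ Ideal.span {algebraMap R B a} := by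
    intro z
    simp only [D', Submodule.mem_colon, smul_eq_mul, SetLike.mem_coe, mul_comm z]
  have h𝔞le : 𝔞 ≤ maximalIdeal B := IsLocalRing.le_maximalIdeal h.ne_top
  have hTspan : ∀ z ∈ Ideal.span {algebraMap R B a}, T z ∈ Ideal.span {a} := by
    intro z hz
    obtain ⟨u, rfl⟩ := Ideal.mem_span_singleton'.mp hz
    rw [mul_comm, IsMulEndColon.map_algebraMap_mul]
    exact Ideal.mul_mem_right _ _ (Ideal.mem_span_singleton_self a)
  rw [cmType_eq_relLength h.left.mem_nonZeroDivisors (hIm h.left.mem_self) hD,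
    cmType_eq_relLength (hT.algebraMap_mem_nonZeroDivisors h.left.mem_nonZeroDivisors)
      ((h.algebraMap_mem_maximalIdeal_iff a).mpr (hIm h.left.mem_self)) hD',
    ← relLength_restrictScalars e]
  have hmap : (D'.restrictScalars R).map T ⊔ Ideal.span {a} = D := by
    refine le_antisymm (sup_le ?_ ?_) ?_
    · rintro _ ⟨z, hz, rfl⟩
      refine (hD _).mpr fun m hm => ?_
      rw [← IsMulEndColon.map_algebraMap_mul]
      exact hTspan _ ((hD' z).mp hz _ ((h.algebraMap_mem_maximalIdeal_iff m).mpr hm))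
    · rw [Ideal.span_singleton_le_iff_mem]
      exact (hD a).mpr fun m _ => Ideal.mul_mem_left _ _ (Ideal.mem_span_singleton_self a)
    · intro z hz
      rw [hD] at hz
      have hzI : z ∈ I := h.left.mem_of_mul_mem_span (by
        rw [mul_comm]
        exact hz _ (hIm (h.left.mem i₁)))
      obtain ⟨r, rfl⟩ := h.left.exists_sum hzI
      have hr : ∀ k, k ≠ i₀ → ∀ m ∈ maximalIdeal R, m * r k ∈ I := by
        intro k hk m hm
        refine h.left.mem_of_sum_mem_span (r := fun k => m * r k) ?_ hk
        have := hz m hm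
        rw [Finset.mul_sum] at this
        simpa only [mul_assoc] using this
      -- The coordinates away from `i₀` lie in `I : 𝔪 ⊆ J = I + (b)`.
      have hs : ∀ k, ∃ s, k ≠ i₀ → r k - s * b ∈ I := by
        intro k
        by_cases hk : k = i₀
        · exact ⟨0, fun h => absurd hk h⟩
        · obtain ⟨s, hs⟩ := h.left.exists_sub_mem h.right h.lt.le
            (h.left.mem_of_forall_mul_mem h.right h.lt (hr k hk))
          exact ⟨s, fun _ => hs⟩
      choose s hs using hs
      classical
      set σ : R := ∑ k ∈ Finset.univ.erase i₀, s k * x k with hσ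
      have hσI : σ ∈ I := Ideal.sum_mem _ fun k _ => I.mul_mem_left _ (h.left.mem k)
      -- Modulo `I² + (a) = (a)`, the given socle element is `bσ = T σ`; what remains is that `σ` is
      -- a socle element modulo `aB`.
      have hdiff : ∑ k, r k * x k = T (algebraMap R B σ) +
          (∑ k ∈ Finset.univ.erase i₀, (r k - s k * b) * x k + r i₀ * a) := by
        rw [hT.map_algebraMap, hσ, Finset.sum_mul, ← add_assoc, ← Finset.sum_add_distrib,
          ← Finset.sum_erase_add _ _ (Finset.mem_univ i₀), h.left.apply_eq]
        congr 1
        exact Finset.sum_congr rfl fun k _ => by ring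
      have hI2 : ∀ z, T z ∈ I ^ 2 → z ∈ Ideal.span {algebraMap R B a} := by
        intro z hz
        rw [h.left.sq_eq] at hz
        obtain ⟨t, ht, hzt⟩ := Ideal.mem_span_singleton_mul.mp hz
        obtain ⟨y, rfl⟩ := hT.exists_eq (h.lt.le ht)
        rw [← IsMulEndColon.map_algebraMap_mul] at hzt
        rw [← hT.injective hzt]
        exact Ideal.mul_mem_right _ _ (Ideal.mem_span_singleton_self _)
      rw [hdiff]
      refine Submodule.add_mem_sup (Submodule.mem_map_of_mem ?_) (add_mem ?_
        (Ideal.mul_mem_left _ _ (Ideal.mem_span_singleton_self a)))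
      · refine (hD' _).mpr fun v hv => ?_
        obtain ⟨m, hm, hv⟩ := h.mem_maximalIdeal_iff.mp hv
        rw [← sub_add_cancel v (algebraMap R B m), add_mul]
        refine add_mem (hI2 _ ?_) (hI2 _ ?_)
        · rw [mul_comm, IsMulEndColon.map_algebraMap_mul, pow_two]
          exact Ideal.mul_mem_mul hσI ((h.mem_iff _).mp hv)
        · rw [IsMulEndColon.map_algebraMap_mul, hT.map_algebraMap, hσ, Finset.sum_mul,
            Finset.mul_sum, pow_two]
          refine Ideal.sum_mem _ fun k hk => ?_
          have hk' := Finset.ne_of_mem_erase hk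
          have e1 : m * (s k * x k * b) = (m * r k - m * (r k - s k * b)) * x k := by ring
          rw [e1]
          exact Ideal.mul_mem_mul (sub_mem (hr k hk' m hm) (I.mul_mem_left _ (hs k hk')))
            (h.left.mem k)
      · have h1 : Ideal.span {a} * I ≤ Ideal.span {a} := Ideal.mul_le_inf.trans inf_le_left
        refine h1 ?_
        rw [← h.left.sq_eq, pow_two]
        exact Ideal.sum_mem _ fun k hk =>
          Ideal.mul_mem_mul (hs k (Finset.ne_of_mem_erase hk)) (h.left.mem k)
  rw [← hmap, relLength_sup_right, relLength_map]
  -- Injectivity of `T` on socles: an element of `D'` comes from some `s ∈ I`, and `sb = at` forces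
  -- `t ∈ J`, so `s` is a multiple of `a` in `B`.
  refine relLength_congr (le_antisymm ?_ ?_)
  · exact le_inf inf_le_left fun z hz => hTspan z hz.2
  · refine le_inf inf_le_left fun z hz => ?_
    obtain ⟨hz1, hz2⟩ := hz
    obtain ⟨s, hs, rfl⟩ := h.exists_eq_algebraMap fun v hv => (hD' z).mp hz1 v (h𝔞le hv)
    change T _ ∈ Ideal.span {a} at hz2
    rw [hT.map_algebraMap] at hz2
    obtain ⟨t, ht⟩ := Ideal.mem_span_singleton.mp hz2
    obtain ⟨γ, rfl⟩ := hT.exists_eq (h.left.mem_of_mul_eq h.right h.lt.le hs ht)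
    refine Ideal.mem_span_singleton.mpr ⟨γ, hT.injective ?_⟩
    rw [hT.map_algebraMap, IsMulEndColon.map_algebraMap_mul, ht]

/-- `C` is the length of `R/(b)`. It bounds `ℓ(R/J)`, and also `ℓ(B/R)`, because `T` embeds `B` in
`R` and sends `1` to `b`. In between, `T` maps `𝔫ᵏ` into `𝔪ᵏ`, and `𝔪ᵏ` maps into `𝔫ᵏ`. -/
theorem exists_length_le (h : IsUlrichBlowup I J a b x i₀ i₁ w j₀ j₁ T 𝔞) {s : ℕ}
    (hs : maximalIdeal R ^ s ≤ Ideal.span {b}) :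
    ∃ C : ℕ, ∀ k,
      relLength ⊤ (maximalIdeal R ^ k) ≤ C + relLength ⊤ (maximalIdeal B ^ k) ∧
      relLength ⊤ (maximalIdeal B ^ k) ≤ C + relLength ⊤ (maximalIdeal R ^ k) := by
  have hT := h.toIsMulEndColon
  have hJm : J ≤ maximalIdeal R := IsLocalRing.le_maximalIdeal h.right.ne_top
  have := h.isLocalHom
  obtain ⟨e⟩ := h.nonempty_residueField_algEquiv
  have hbJ : Ideal.span {b} ≤ J := (Ideal.span_singleton_le_iff_mem _).mpr h.right.mem_self
  obtain ⟨C, hC⟩ := ENat.ne_top_iff_exists.mp (relLength_top_ne_top_of_pow_le hs)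
  refine ⟨C, fun k => ?_⟩
  rw [hC, ← relLength_restrictScalars e (V := B), Submodule.restrictScalars_top]
  set N := (maximalIdeal B ^ k).restrictScalars R
  have hTN : N ≤ Submodule.comap T (maximalIdeal R ^ k) := by
    rcases k with - | k
    · simp
    · intro z hz
      have hz' := h.maximalIdeal_pow_succ_le k hz
      rw [← smul_eq_mul, ← Submodule.restrictScalars_mem R, Ideal.smul_restrictScalars] at hz'
      refine Submodule.smul_induction_on hz' (fun r hr y _ => ?_) (fun u v hu hv => add_mem hu hv)
      rw [Submodule.mem_comap, map_smul, pow_succ]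
      exact Ideal.mul_mem_mul hr (hJm (hT.mem y))
  constructor
  · refine (relLength_mono_left (le_sup_left : ⊤ ≤ ⊤ ⊔ maximalIdeal R ^ k) _).trans ?_
    rw [relLength_add (N' := J ⊔ maximalIdeal R ^ k) le_sup_right (sup_le_sup_right le_top _),
      relLength_sup_right]
    refine add_le_add ?_ ?_
    · rw [top_sup_eq]
      exact relLength_anti_right _ (hbJ.trans le_sup_left)
    · rw [← hT.range_eq, LinearMap.range_eq_map, relLength_map]
      exact relLength_anti_right _ hTN
  · let ψ := Algebra.linearMap R B
    refine (relLength_mono_left (le_sup_left : ⊤ ≤ ⊤ ⊔ N) _).trans ?_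
    rw [relLength_add (N' := LinearMap.range ψ ⊔ N) le_sup_right (sup_le_sup_right le_top _),
      relLength_sup_right]
    refine add_le_add ?_ ?_
    · rw [top_sup_eq]
      refine (relLength_anti_right _ le_sup_left).trans ?_
      rw [← relLength_map_map hT.injective]
      refine (relLength_mono_left le_top _).trans (relLength_anti_right _ ?_)
      rw [Ideal.span_singleton_le_iff_mem]
      exact ⟨1, ⟨1, map_one (algebraMap R B)⟩, hT.map_one⟩
    · rw [LinearMap.range_eq_map, relLength_map]
      refine relLength_anti_right _ fun r hr => ?_
      have h1 : (maximalIdeal R).map (algebraMap R B) ≤ maximalIdeal B := by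
        rw [h.maximalIdeal_eq]
        exact le_sup_left
      have h2 := Ideal.pow_right_mono h1 k
      rw [← Ideal.map_pow] at h2
      exact h2 (Ideal.mem_map_of_mem _ hr)

theorem tendsto_hilbertSamuelRatio (h : IsUlrichBlowup I J a b x i₀ i₁ w j₀ j₁ T 𝔞) {s : ℕ}
    (hs : maximalIdeal R ^ s ≤ Ideal.span {b}) {e : ℝ}
    (he : Tendsto (hilbertSamuelRatio R) atTop (𝓝 e)) :
    Tendsto (hilbertSamuelRatio B) atTop (𝓝 e) := by
  have := h.isNoetherianRing
  obtain ⟨C, hC⟩ := h.exists_length_le hs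
  have hdiff : Tendsto (fun k => hilbertSamuelRatio B k - hilbertSamuelRatio R k) atTop (𝓝 0) := by
    refine squeeze_zero_norm (fun k => ?_) (tendsto_const_div_atTop_nhds_zero_nat (C : ℝ))
    obtain ⟨h1, h2⟩ := hC k
    obtain ⟨p, hp⟩ := ENat.ne_top_iff_exists.mp (relLength_top_maximalIdeal_pow_ne_top (R := R) k)
    obtain ⟨q, hq⟩ := ENat.ne_top_iff_exists.mp (relLength_top_maximalIdeal_pow_ne_top (R := B) k)
    rw [← hp, ← hq] at h1 h2
    unfold hilbertSamuelRatio
    rw [← relLength_top, ← relLength_top, ← hp, ← hq, ENat.toNat_natCast, ENat.toNat_natCast, ← sub_div,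
      Real.norm_eq_abs, abs_div, Nat.abs_cast]
    have h1' : (p : ℝ) ≤ C + q := by exact_mod_cast h1
    have h2' : (q : ℝ) ≤ C + p := by exact_mod_cast h2
    gcongr
    rw [abs_le]
    constructor <;> linarith
  simpa using hdiff.add he

end IsUlrichBlowup

end

noncomputable section

/-! ### Realisation inside the total ring of fractions. -/

section TotalRingOfFractions

variable {R K : Type*} [CommRing R] [CommRing K] [Algebra R K] {I J : Ideal R} {b : R}

theorem mem_endColon {z : K} :
    z ∈ endColon K J ↔ ∀ j ∈ J, ∃ j' ∈ J, algebraMap R K j' = z * algebraMap R K j := by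
  change z ∈ IsLocalization.coeSubmodule K J / IsLocalization.coeSubmodule K J ↔ _
  simp only [Submodule.mem_div_iff_forall_mul_mem, IsLocalization.mem_coeSubmodule,
    forall_exists_index, and_imp, forall_apply_eq_imp_iff₂]

theorem mem_fracBy {z : K} :
    z ∈ fracBy K I b ↔ ∃ i ∈ I, algebraMap R K i = algebraMap R K b * z := by
  simp only [fracBy, Submodule.mem_comap, IsLocalization.mem_coeSubmodule, LinearMap.lsmul_apply,
    Algebra.smul_def]

theorem mem_idealToSubmodule {B : Subalgebra R K} {𝔟 : Ideal B} {z : K} :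
    z ∈ idealToSubmodule 𝔟 ↔ ∃ y ∈ 𝔟, (y : K) = z := by
  simp [idealToSubmodule, Submodule.mem_map]

variable [IsFractionRing R K]

/-- `J : J` is `b⁻¹J`: one inclusion because `b ∈ J`, the other because `J² = bJ`. -/
theorem exists_isMulEndColon (hb : b ∈ nonZeroDivisors R) (hbJ : b ∈ J)
    (hsq : J ^ 2 = Ideal.span {b} * J) :
    ∃ T : endColon K J →ₗ[R] R, IsMulEndColon J b T ∧
      ∀ z, algebraMap R K (T z) = algebraMap R K b * z := by
  have hinj : Function.Injective (algebraMap R K) := IsFractionRing.injective R K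
  have hu : IsUnit (algebraMap R K b) := IsLocalization.map_units K ⟨b, hb⟩
  have hex : ∀ z : endColon K J, ∃ j ∈ J, algebraMap R K j = algebraMap R K b * z := fun z => by
    obtain ⟨j, hj, h⟩ := mem_endColon.mp z.2 b hbJ
    exact ⟨j, hj, h.trans (mul_comm _ _)⟩
  choose f hfJ hf using hex
  let T : endColon K J →ₗ[R] R :=
    { toFun := f
      map_add' := fun u v => hinj (by
        rw [hf, map_add, hf, hf, Subalgebra.coe_add, mul_add])
      map_smul' := fun r u => hinj (by
        rw [hf, RingHom.id_apply, smul_eq_mul, map_mul, hf, Subalgebra.coe_smul, Algebra.smul_def]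
        ring) }
  have hT : ∀ z, algebraMap R K (T z) = algebraMap R K b * z := hf
  refine ⟨T, ⟨fun u v huv => ?_, ?_, ?_, fun u v => ?_⟩, hT⟩
  · apply Subtype.ext
    rw [← hu.mul_right_inj, ← hT, ← hT, huv]
  · refine le_antisymm (by rintro _ ⟨z, rfl⟩; exact hfJ z) fun j hj => ?_
    obtain ⟨z, hz⟩ := hu.exists_right_inv
    have hmem : z * algebraMap R K j ∈ endColon K J := by
      refine mem_endColon.mpr fun i hi => ?_
      obtain ⟨t, ht, h⟩ := exists_mem_eq_mul_of_sq_eq hsq hj hi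
      refine ⟨t, ht, ?_⟩
      rw [mul_assoc, ← map_mul, h, map_mul, ← mul_assoc, mul_comm z, hz, one_mul]
    refine ⟨⟨_, hmem⟩, hinj ?_⟩
    rw [hT, ← mul_assoc, hz, one_mul]
  · apply hinj
    rw [hT, Subalgebra.coe_one, mul_one]
  · apply hinj
    rw [map_mul, map_mul, hT, hT, hT, Subalgebra.coe_mul]
    ring

namespace IsUlrichBlowup

variable {ι κ : Type*} [Fintype ι] [Fintype κ] {a : R}
  {x : ι → R} {i₀ i₁ : ι} {w : κ → R} {j₀ j₁ : κ} {T : endColon K J →ₗ[R] R}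
  {𝔞 : Ideal (endColon K J)}

theorem idealToSubmodule_eq (h : IsUlrichBlowup I J a b x i₀ i₁ w j₀ j₁ T 𝔞)
    (hT : ∀ z, algebraMap R K (T z) = algebraMap R K b * z) :
    idealToSubmodule 𝔞 = fracBy K I b := by
  have hu : IsUnit (algebraMap R K b) :=
    IsLocalization.map_units K ⟨b, h.right.mem_nonZeroDivisors⟩
  ext z
  rw [mem_idealToSubmodule, mem_fracBy]
  constructor
  · rintro ⟨y, hy, rfl⟩
    exact ⟨T y, (h.mem_iff y).mp hy, hT y⟩
  · rintro ⟨i, hi, hz⟩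
    obtain ⟨y, rfl⟩ := h.toIsMulEndColon.exists_eq (h.lt.le hi)
    refine ⟨y, (h.mem_iff y).mpr hi, ?_⟩
    rwa [hT, hu.mul_right_inj] at hz

theorem toSubmodule_eq (h : IsUlrichBlowup I J a b x i₀ i₁ w j₀ j₁ T 𝔞)
    (hT : ∀ z, algebraMap R K (T z) = algebraMap R K b * z) :
    Subalgebra.toSubmodule (endColon K J) = 1 ⊔ fracBy K I b := by
  rw [← h.idealToSubmodule_eq hT]
  refine le_antisymm (fun z hz => ?_) (sup_le ?_ ?_)
  · obtain ⟨r, hr⟩ := h.exists_sub_algebraMap_mem ⟨z, hz⟩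
    rw [← add_sub_cancel (algebraMap R K r) z]
    exact Submodule.add_mem_sup (Submodule.mem_one.mpr ⟨r, rfl⟩)
      (mem_idealToSubmodule.mpr ⟨_, hr, rfl⟩)
  · exact Submodule.one_le.mpr (one_mem (endColon K J))
  · intro z hz
    obtain ⟨y, -, rfl⟩ := mem_idealToSubmodule.mp hz
    exact y.2

theorem fracBy_eq_div (h : IsUlrichBlowup I J a b x i₀ i₁ w j₀ j₁ T 𝔞)
    (hT : ∀ z, algebraMap R K (T z) = algebraMap R K b * z) :
    fracBy K I b = IsLocalization.coeSubmodule K I / IsLocalization.coeSubmodule K J := by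
  ext z
  simp only [Submodule.mem_div_iff_forall_mul_mem, IsLocalization.mem_coeSubmodule,
    forall_exists_index, and_imp, forall_apply_eq_imp_iff₂]
  constructor
  · intro hz j hj
    rw [← h.idealToSubmodule_eq hT] at hz
    obtain ⟨ζ, hζ, rfl⟩ := mem_idealToSubmodule.mp hz
    obtain ⟨y, rfl⟩ := h.toIsMulEndColon.exists_eq hj
    refine ⟨T (ζ * y), (h.mem_iff _).mp (𝔞.mul_mem_right y hζ), ?_⟩
    rw [hT, hT, Subalgebra.coe_mul]
    ring
  · intro hz
    obtain ⟨i, hi, h'⟩ := hz b h.right.mem_self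
    exact mem_fracBy.mpr ⟨i, hi, h'.trans (mul_comm _ _)⟩

theorem idealToSubmodule_maximalIdeal_eq [IsLocalRing R] [IsNoetherianRing R]
    [IsLocalRing (endColon K J)]
    (h : IsUlrichBlowup I J a b x i₀ i₁ w j₀ j₁ T 𝔞)
    (hT : ∀ z, algebraMap R K (T z) = algebraMap R K b * z) :
    idealToSubmodule (maximalIdeal (endColon K J)) =
      IsLocalization.coeSubmodule K (maximalIdeal R) ⊔ fracBy K I b := by
  rw [← h.idealToSubmodule_eq hT]
  refine le_antisymm (fun z hz => ?_) (sup_le (fun z hz => ?_) fun z hz => ?_)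
  · obtain ⟨y, hy, rfl⟩ := mem_idealToSubmodule.mp hz
    obtain ⟨r, hr, hyr⟩ := h.mem_maximalIdeal_iff.mp hy
    rw [← add_sub_cancel (algebraMap R K r) (y : K)]
    exact Submodule.add_mem_sup ((IsLocalization.mem_coeSubmodule _ _).mpr ⟨r, hr, rfl⟩)
      (mem_idealToSubmodule.mpr ⟨_, hyr, rfl⟩)
  · obtain ⟨r, hr, rfl⟩ := (IsLocalization.mem_coeSubmodule _ _).mp hz
    exact mem_idealToSubmodule.mpr ⟨_, (h.algebraMap_mem_maximalIdeal_iff r).mpr hr, rfl⟩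
  · obtain ⟨y, hy, rfl⟩ := mem_idealToSubmodule.mp hz
    exact mem_idealToSubmodule.mpr ⟨y, IsLocalRing.le_maximalIdeal h.ne_top hy, rfl⟩

end IsUlrichBlowup

end TotalRingOfFractions

end

theorem theorem3p7 {R : Type*} [CommRing R] [IsCohenMacaulayLocalRing R]
    (hdim : ringKrullDim R = 1)
    {K : Type*} [CommRing K] [Algebra R K] [IsFractionRing R K]
    (I J : Ideal R) (hI : IsUlrichIdeal I) (hJ : IsUlrichIdeal J) (hIJ : I < J)
    (b : R) (hbJ : b ∈ J) (hb : J ^ 2 = Ideal.span {b} * J) :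
    -- `b` is a unit of `K`, so that `I / b` makes sense
    IsUnit (algebraMap R K b) ∧
    -- (1)
    Subalgebra.toSubmodule (endColon K J) = 1 ⊔ fracBy K I b ∧
    fracBy K I b = IsLocalization.coeSubmodule K I / IsLocalization.coeSubmodule K J ∧
    -- (2)
    ∃ _ : IsCohenMacaulayLocalRing (endColon K J),
      ringKrullDim (endColon K J) = 1 ∧
      idealToSubmodule (maximalIdeal (endColon K J)) =
        IsLocalization.coeSubmodule K (maximalIdeal R) ⊔ fracBy K I b ∧
      Nonempty (ResidueField R ≃ₐ[R] ResidueField (endColon K J)) ∧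
      -- (3)
      (∃ 𝔞 : Ideal (endColon K J), idealToSubmodule 𝔞 = fracBy K I b ∧
        IsUlrichIdeal 𝔞 ∧ 𝔞.spanFinrank = I.spanFinrank) ∧
      -- (4)
      cmType (endColon K J) = cmType R ∧
      Tendsto (hilbertSamuelRatio R) atTop (𝓝 (localMultiplicity R)) ∧
      Tendsto (hilbertSamuelRatio (endColon K J)) atTop (𝓝 (localMultiplicity (endColon K J))) ∧
      localMultiplicity (endColon K J) = localMultiplicity R ∧
      ((embeddingDim (endColon K J) : ℝ) = localMultiplicity (endColon K J) ↔
        (embeddingDim R : ℝ) = localMultiplicity R) := by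
  obtain ⟨y, hy, hym⟩ := IsCohenMacaulayLocalRing.exists_mem_nonZeroDivisors hdim
  obtain ⟨a, haI, -, hne, hsq⟩ := hI.exists_parameter
  obtain ⟨c, hcJ, -, hcne, hcsq⟩ := hJ.exists_parameter
  obtain ⟨ha, p, hp⟩ := mem_nonZeroDivisors_of_sq_eq hI.radical_eq hsq hy hym
  obtain ⟨hbR, s, hs⟩ := mem_nonZeroDivisors_of_sq_eq hJ.radical_eq hb hy hym
  have := hI.free_cotangent
  have := hJ.free_cotangent
  obtain ⟨m, x, i₀, i₁, hx⟩ := exists_isUlrichBasis haI ha hsq hne hI.ne_top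
  obtain ⟨n, w, j₀, j₁, hw⟩ := exists_isUlrichBasis hbJ hbR hb
    (ne_span_singleton_of_sq_eq hbR hbJ hcJ hcsq hcne) hJ.ne_top
  obtain ⟨T, hT, hTK⟩ := exists_isMulEndColon (K := K) hbR hbJ hb
  obtain ⟨𝔞, h⟩ := exists_isUlrichBlowup hx hw hIJ hT
  refine ⟨IsLocalization.map_units K ⟨b, hbR⟩, h.toSubmodule_eq hTK, h.fracBy_eq_div hTK, ?_⟩
  have := h.isLocalRing
  obtain ⟨hCM, hdimB⟩ := h.isCohenMacaulayLocalRing hs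
  obtain ⟨h𝔞, hrank⟩ := h.isUlrichIdeal hp
  obtain ⟨e, he, hmin⟩ := hI.exists_multiplicity hy hym
  have hbB := hT.algebraMap_mem_nonZeroDivisors hbR
  obtain ⟨e', he', hmin'⟩ := h𝔞.exists_multiplicity hbB
    ((h.algebraMap_mem_maximalIdeal_iff b).mpr h.param_mem)
  have heB := h.tendsto_hilbertSamuelRatio hs he
  -- The two integers come from separate applications of the criterion, to `R` with `I` and to `B`
  -- with `𝔞`; uniqueness of limits identifies them.
  obtain rfl : e' = e := by exact_mod_cast tendsto_nhds_unique he' heB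
  have hR : localMultiplicity R = e' := he.limUnder_eq
  have hB : localMultiplicity (endColon K J) = e' := heB.limUnder_eq
  refine ⟨hCM, hdimB, h.idealToSubmodule_maximalIdeal_eq hTK, h.nonempty_residueField_algEquiv,
    ⟨𝔞, h.idealToSubmodule_eq hTK, h𝔞, ?_⟩, h.cmType_eq, hR ▸ he, hB ▸ heB, hB.trans hR.symm, ?_⟩
  · rw [hrank, hx.spanFinrank_eq hI.ne_top]
  -- Both sides become `r + 1 = e` with the same `r` and `e`.
  · rw [hR, hB, Nat.cast_inj, Nat.cast_inj, hmin, hmin', h.cmType_eq]
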